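/- Let $m\ge 0$ be an integer, $E_m=\{1,\dots,m\}$, and let $P$ be an $m$-user multiple access channel with binary inputs and arbitrary output alphabet $\mathcal Y$: $\mathcal Y$ is a measurable space and $P(\cdot\mid x)$ is a probability measure on $\mathcal Y$ for every $x=(x[1],\dots,x[m])\in\mathbb F_2^m$. For $n=2^l$ let $G_n=\begin{bmatrix}1&0\\1&1\end{bmatrix}^{\otimes l}$ (Kronecker power over $\mathbb F_2$). Let $U_1,\dots,U_n$ be independent and uniform on $\mathbb F_2^m$, put $(X_1[k],\dots,X_n[k])=(U_1[k],\dots,U_n[k])\,G_n$ for every $k\in E_m$, and let $Y^n=(Y_1,\dots,Y_n)$ be the output when $X_1,\dots,X_n$ are sent over $n$ independent uses of $P$. For $1\le i\le n$ let $P_{(i)}$ be the $m$-user channel with input $U_i$ and output $(Y^n,U_1,\dots,U_{i-1})$, that is, $P_{(i)}(\cdot\mid a)$ is the conditional law of $(Y^n,U_1,\dots,U_{i-1})$ given $U_i=a$. For an $m$-user binary-input channel $W$ and $S\subseteq E_m$, let $W^{[S]}$ be the single-user binary-input channel $$W^{[S]}(\cdot\mid s)=\frac1{2^{m-1}}\sum_{x\in\mathbb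 F_2^m:\ \sum_{k\in S}x[k]=s}W(\cdot\mid x),\qquad s\in\mathbb F_2,$$ which carries the parity of the inputs in $S$. For a single-user binary-input channel $Q$ let $I(Q)$ be the mutual information in bits between the two coordinates of the joint law $\frac12 Q(dy\mid s)$ of the input $s$ and the output $y$; thus $I(W^{[S]})=I\bigl(\sum_{k\in S}X[k];Y\bigr)$ for $X$ uniform on $\mathbb F_2^m$ and $Y$ the output of $W$ with input $X$ (this is $0$ if $S=\emptyset$). Then for every $S\subseteq E_m$, every $\varepsilon\in(0,1)$ and every real $\alpha<1/2$, $$\lim_{l\to\infty}\frac1n\Bigl|\Bigl\{i\in\{1,\dots,n\}:\ I\bigl((P_{(i)})^{[S]}\bigr)>1-\varepsilon\ \text{ and }\ I\bigl((P_{(i)})^{[S]}\bigr)<1-2^{-n^{\alpha}}\Bigr\}\Bigr|=0,\qquad n=2^l.$$ -/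

import Mathlib

open MeasureTheory Filter Topology
open scoped ENNReal Kronecker

namespace MACPolar

/-- The `m`-tuples of input bits of the `m` users, i.e. `𝔽₂ ^ m`. -/
abbrev Inputs (m : ℕ) : Type := Fin m → ZMod 2

/-- The `2 × 2` kernel `[1 0; 1 1]` over `𝔽₂`. -/
def kernelMatrix : Matrix (Fin 2) (Fin 2) (ZMod 2) := !![1, 0; 1, 1]

/-- The `l`-th Kronecker power of `[1 0; 1 1]`, with rows and columns in the usual
(lexicographic) order. -/
def polarMatrix : (l : ℕ) → Matrix (Fin (2 ^ l)) (Fin (2 ^ l)) (ZMod 2)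
  | 0 => 1
  | l + 1 =>
    Matrix.reindex (finProdFinEquiv.trans (finCongr (pow_succ 2 l).symm))
      (finProdFinEquiv.trans (finCongr (pow_succ 2 l).symm))
      (polarMatrix l ⊗ₖ kernelMatrix)

/-- Every user `k` encodes its row `(u₁[k], …, uₙ[k])`, `n = 2 ^ l`, as `u[k] Gₙ`. -/
def encode {m : ℕ} (l : ℕ) (u : Fin (2 ^ l) → Inputs m) : Fin (2 ^ l) → Inputs m :=
  fun j k => Matrix.vecMul (fun i => u i k) (polarMatrix l) j

/-- The synthesized `m`-user channel `U_i ↦ (Y₁ … Yₙ, U₁ … U_{i-1})`, `n = 2 ^ l`: the conditional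
law of `(Y, (U_j)_{j < i})` given `U_i = a`, when the `U_j` are independent and uniform and the
encoded words are sent over `n` independent uses of `P`. -/
noncomputable def synthChannel {m : ℕ} {Y : Type*} [MeasurableSpace Y]
    (P : Inputs m → Measure Y) (l : ℕ) (i : Fin (2 ^ l)) (a : Inputs m) :
    Measure ((Fin (2 ^ l) → Y) × (Set.Iio i → Inputs m)) :=
  ∑ u : Fin (2 ^ l) → Inputs m with u i = a,
    ((2 ^ m : ℝ≥0∞) ^ (2 ^ l - 1))⁻¹ •
      (Measure.pi fun j => P (encode l u j)).prod
        (Measure.dirac fun j : Set.Iio i => u j)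

/-- The single-user channel `∑_{i ∈ S} X_i ↦ Y` obtained from an `m`-user channel, with
`2 / 2 ^ m = 1 / 2 ^ (m - 1)`. For `S = ∅` the input symbol `1` never occurs, and the formula gives
total mass `2` to the output given `0` and total mass `0` to the output given `1`. -/
noncomputable def parityChannel {m : ℕ} {Y : Type*} [MeasurableSpace Y]
    (P : Inputs m → Measure Y) (S : Finset (Fin m)) (s : ZMod 2) : Measure Y :=
  ∑ x : Inputs m with ∑ i ∈ S, x i = s, (2 / 2 ^ m : ℝ≥0∞) • P x

/-- The mutual information, in bits, of the two coordinates under a joint law `ρ`. -/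
noncomputable def mutualInfo {A B : Type*} [MeasurableSpace A] [MeasurableSpace B]
    (ρ : Measure (A × B)) : ℝ :=
  (InformationTheory.klDiv ρ (ρ.fst.prod ρ.snd)).toReal / Real.log 2

/-- The joint law of input and output of a binary-input channel: `(s, dy)` has weight
`Q(dy | s) / 2`. -/
noncomputable def jointLaw {Y : Type*} [MeasurableSpace Y] (Q : ZMod 2 → Measure Y) :
    Measure (ZMod 2 × Y) :=
  ∑ s : ZMod 2, (2⁻¹ : ℝ≥0∞) • (Measure.dirac s).prod (Q s)

/-- The uniform-input mutual information `I(Q)` of a binary-input channel, in bits. -/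
noncomputable def info {Y : Type*} [MeasurableSpace Y] (Q : ZMod 2 → Measure Y) : ℝ :=
  mutualInfo (jointLaw Q)

end MACPolar

/-! Fix a nonempty `S` and write `W` for a synthesized channel. Under the minus transform the parity
channel of `W` undergoes exactly the single-user minus transform. Under the plus transform it
becomes at least as good as the single-user plus transform, because the receiver learns a whole
vector of bits and not only its parity. Hence a bound `z` on the Bhattacharyya parameter of the
parity channel yields the bounds `2z` and `z²` for its two children (`bhattBound_minus`,
`bhattBound_plus`). Such a bound is certified by test functions `f₀, f₁` with `f₀ f₁ ≥ 1` and `∫ f_s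
dQ_s ≤ z`. These certificates combine under products and mixtures, so densities are needed only for
the comparison with mutual information.

With `z = 2 ^ (-L)` the two steps read `L ↦ L - 1` and `L ↦ 2L`, and the asymptotics use nothing
else (`ExponentTree`). The potential `kap` falls on average at each step, by a definite amount
unless it is near `0` or `1` (`kap_children`). Its level averages therefore converge and the average
of `kap * (1 - kap)` tends to `0`: nodes polarize into exponents that are large or near `0`, without
any chain rule for information.

For the rate, `L ^ (-s)` with small `s > 0` contracts on average by nearly `(1 + 2 ^ (-s)) / 2` as
long as `L` stays large, and `kap` bounds the probability of falling back (`ratePot_children`). To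
first order in `s` this factor is `2 ^ (-s / 2)`, so exponents `2 ^ (β l)` are reached for every `β
< 1/2` (`tendsto_fraction`). Finally `one_sub_info_le` and `bhattBound_of_info` translate between
information and Bhattacharyya bounds. -/

namespace MACPolar

/-! ### Index splitting and level averages -/

/-- The splitting of the indices of level `l + 1` into an index of level `l` and a final bit. -/
def splitEquiv (l : ℕ) : Fin (2 ^ l) × Fin 2 ≃ Fin (2 ^ (l + 1)) :=
  finProdFinEquiv.trans (finCongr (pow_succ 2 l).symm)

/-- The average of a function over the nodes of level `l`. -/
noncomputable def levelMean (l : ℕ) (f : Fin (2 ^ l) → ℝ) : ℝ := (∑ i, f i) / 2 ^ l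

lemma levelMean_mono {l : ℕ} {f g : Fin (2 ^ l) → ℝ} (h : ∀ i, f i ≤ g i) :
    levelMean l f ≤ levelMean l g := by
  unfold levelMean
  gcongr with i
  exact h i

lemma levelMean_add (l : ℕ) (f g : Fin (2 ^ l) → ℝ) :
    levelMean l (fun i => f i + g i) = levelMean l f + levelMean l g := by
  simp [levelMean, Finset.sum_add_distrib, add_div]

lemma levelMean_sub (l : ℕ) (f g : Fin (2 ^ l) → ℝ) :
    levelMean l (fun i => f i - g i) = levelMean l f - levelMean l g := by
  simp [levelMean, Finset.sum_sub_distrib, sub_div]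

lemma levelMean_const_mul (l : ℕ) (c : ℝ) (f : Fin (2 ^ l) → ℝ) :
    levelMean l (fun i => c * f i) = c * levelMean l f := by
  rw [levelMean, levelMean, ← Finset.mul_sum, mul_div_assoc]

lemma levelMean_const (l : ℕ) (c : ℝ) : levelMean l (fun _ => c) = c := by
  simp [levelMean]

lemma levelMean_nonneg {l : ℕ} {f : Fin (2 ^ l) → ℝ} (h : ∀ i, 0 ≤ f i) : 0 ≤ levelMean l f :=
  div_nonneg (Finset.sum_nonneg fun i _ => h i) (by positivity)

lemma levelMean_indicator (l : ℕ) (s : Set (Fin (2 ^ l))) :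
    levelMean l (s.indicator 1) = s.ncard / 2 ^ l := by
  classical
  rw [levelMean, Set.ncard_eq_toFinset_card']
  simp [Set.indicator_apply]

lemma levelMean_succ (l : ℕ) (f : Fin (2 ^ (l + 1)) → ℝ) :
    levelMean (l + 1) f =
      levelMean l (fun i => (f (splitEquiv l (i, 0)) + f (splitEquiv l (i, 1))) / 2) := by
  simp only [levelMean]
  rw [← (splitEquiv l).sum_comp, Fintype.sum_prod_type, ← Finset.sum_div, div_div,
    show (2 : ℝ) * 2 ^ l = 2 ^ (l + 1) by ring]
  simp only [Fin.sum_univ_two]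

/-! ### Exponents of reliability on the binary tree of synthesized channels -/

/-- A family of sets of admissible exponents `L` (meaning that `2 ^ (-L)` bounds the Bhattacharyya
parameter) which is compatible with the two polar transforms. -/
structure ExponentTree (G : (l : ℕ) → Fin (2 ^ l) → ℝ → Prop) : Prop where
  zero : ∀ l i, G l i 0
  anti : ∀ l i L L', L' ≤ L → G l i L → G l i L'
  minus : ∀ l i L, G l i L → G (l + 1) (splitEquiv l (i, 0)) (L - 1)
  plus : ∀ l i L, G l i L → G (l + 1) (splitEquiv l (i, 1)) (2 * L)

/-- The least value of `ψ` over the nonnegative admissible exponents. -/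
noncomputable def pot (G : (l : ℕ) → Fin (2 ^ l) → ℝ → Prop) (ψ : ℝ → ℝ) (l : ℕ)
    (i : Fin (2 ^ l)) : ℝ :=
  sInf (ψ '' {L | 0 ≤ L ∧ G l i L})

section Tree

variable {G : (l : ℕ) → Fin (2 ^ l) → ℝ → Prop}

lemma pot_le {ψ : ℝ → ℝ} (hψ : ∀ L, 0 ≤ L → 0 ≤ ψ L) {l : ℕ} {i : Fin (2 ^ l)} {L : ℝ}
    (hL : 0 ≤ L) (h : G l i L) : pot G ψ l i ≤ ψ L :=
  csInf_le ⟨0, by rintro _ ⟨L, hL, rfl⟩; exact hψ L hL.1⟩ ⟨L, ⟨hL, h⟩, rfl⟩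

lemma le_pot (hG : ExponentTree G) {ψ : ℝ → ℝ} {l : ℕ} {i : Fin (2 ^ l)} {c : ℝ}
    (h : ∀ L, 0 ≤ L → G l i L → c ≤ ψ L) : c ≤ pot G ψ l i := by
  refine le_csInf ⟨ψ 0, 0, ⟨le_rfl, hG.zero l i⟩, rfl⟩ ?_
  rintro _ ⟨L, ⟨hL, hGL⟩, rfl⟩
  exact h L hL hGL

lemma exists_lt_of_pot_lt (hG : ExponentTree G) {ψ : ℝ → ℝ} {l : ℕ} {i : Fin (2 ^ l)} {c : ℝ}
    (h : pot G ψ l i < c) : ∃ L, 0 ≤ L ∧ G l i L ∧ ψ L < c := by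
  by_contra! H
  exact absurd (le_pot hG H) (not_le.2 h)

lemma pot_children_le (hG : ExponentTree G) {ψ : ℝ → ℝ} (hψ : ∀ L, 0 ≤ L → 0 ≤ ψ L) {l : ℕ}
    {i : Fin (2 ^ l)} {L : ℝ} (hL : 0 ≤ L) (h : G l i L) :
    pot G ψ (l + 1) (splitEquiv l (i, 0)) + pot G ψ (l + 1) (splitEquiv l (i, 1)) ≤
      ψ (max (L - 1) 0) + ψ (2 * L) := by
  refine add_le_add (pot_le hψ (le_max_right _ _) ?_) (pot_le hψ (by positivity) (hG.plus _ _ _ h))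
  rcases max_choice (L - 1) 0 with h' | h' <;> rw [h']
  · exact hG.minus _ _ _ h
  · exact hG.zero _ _

/-- The bounded potential `10 / (10 + L²)`. -/
noncomputable def kap (L : ℝ) : ℝ := 10 / (10 + L ^ 2)

lemma kap_pos (L : ℝ) : 0 < kap L := by unfold kap; positivity

lemma kap_le_one (L : ℝ) : kap L ≤ 1 := by
  unfold kap
  rw [div_le_one (by positivity)]
  nlinarith [sq_nonneg L]

lemma kap_anti {L L' : ℝ} (h : 0 ≤ L) (h' : L ≤ L') : kap L' ≤ kap L := by
  unfold kap
  gcongr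

lemma kap_lt_one {L : ℝ} (h : 0 < L) : kap L < 1 := by
  unfold kap
  rw [div_lt_one (by positivity)]
  nlinarith [sq_pos_of_pos h]

/-- Near `0`, `1 - kap L` is of order `L²`: the plus step multiplies it by about `4`, which
outweighs its complete loss in the minus step. For large `L`, `kap L` is about `10 / L²` and the
children sum to about `5/4` of it, below `2`. The constant `10` makes the intermediate range work as
well. -/
lemma kap_children {L : ℝ} (hL : 0 ≤ L) :
    kap (max (L - 1) 0) + kap (2 * L) ≤ 2 * kap L - kap L * (1 - kap L) / 4 := by
  have e : kap L * (1 - kap L) = 10 * L ^ 2 / (10 + L ^ 2) ^ 2 := by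
    unfold kap; field_simp; ring
  rw [e]
  unfold kap
  rw [← sub_nonneg]
  rcases le_total L 1 with h | h
  · rw [max_eq_right (by linarith)]
    have : 2 * (10 / (10 + L ^ 2)) - 10 * L ^ 2 / (10 + L ^ 2) ^ 2 / 4 -
        (10 / (10 + 0 ^ 2) + 10 / (10 + (2 * L) ^ 2)) =
        L ^ 2 * ((20 - 4 * L ^ 2) * (10 + L ^ 2) - 10 / 4 * (10 + 4 * L ^ 2)) /
          ((10 + L ^ 2) ^ 2 * (10 + (2 * L) ^ 2)) := by
      field_simp; ring
    rw [this]
    have h2 : L ^ 2 ≤ 1 := by nlinarith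
    have : 0 ≤ (20 - 4 * L ^ 2) * (10 + L ^ 2) - 10 / 4 * (10 + 4 * L ^ 2) := by
      nlinarith [sq_nonneg L]
    positivity
  · rw [max_eq_left (by linarith)]
    have : 2 * (10 / (10 + L ^ 2)) - 10 * L ^ 2 / (10 + L ^ 2) ^ 2 / 4 -
        (10 / (10 + (L - 1) ^ 2) + 10 / (10 + (2 * L) ^ 2)) =
        10 * ((3 * L ^ 4 - 14 * L ^ 3 + 37 * L ^ 2 - 20 * L + 10) * (10 + L ^ 2) -
          L ^ 2 / 4 * (10 + 4 * L ^ 2) * (10 + (L - 1) ^ 2)) /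
          ((10 + L ^ 2) ^ 2 * (10 + (2 * L) ^ 2) * (10 + (L - 1) ^ 2)) := by
      field_simp; ring
    rw [this]
    obtain ⟨x, rfl⟩ : ∃ x, L = 1 + x := ⟨L - 1, by ring⟩
    have hx : 0 ≤ x := by linarith
    have : 0 ≤ (3 * (1 + x) ^ 4 - 14 * (1 + x) ^ 3 + 37 * (1 + x) ^ 2 - 20 * (1 + x) + 10) *
        (10 + (1 + x) ^ 2) -
          (1 + x) ^ 2 / 4 * (10 + 4 * (1 + x) ^ 2) * (10 + ((1 + x) - 1) ^ 2) := by
      nlinarith [sq_nonneg (x ^ 2 - x), sq_nonneg x, pow_nonneg hx 3, pow_nonneg hx 4,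
        pow_nonneg hx 5, pow_nonneg hx 6, mul_nonneg hx (sq_nonneg (x - 1)),
        sq_nonneg (x - 1), mul_nonneg hx (sq_nonneg (x ^ 2 - x)), sq_nonneg (x ^ 3 - x ^ 2)]
    positivity

lemma pot_kap_nonneg (hG : ExponentTree G) (l : ℕ) (i : Fin (2 ^ l)) : 0 ≤ pot G kap l i :=
  le_pot hG fun L _ _ => (kap_pos L).le

lemma pot_kap_le_one (hG : ExponentTree G) (l : ℕ) (i : Fin (2 ^ l)) : pot G kap l i ≤ 1 :=
  (pot_le (fun L _ => (kap_pos L).le) le_rfl (hG.zero l i)).trans (kap_le_one 0)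

lemma pot_kap_children_le (hG : ExponentTree G) (l : ℕ) (i : Fin (2 ^ l)) :
    pot G kap (l + 1) (splitEquiv l (i, 0)) + pot G kap (l + 1) (splitEquiv l (i, 1)) ≤
      2 * pot G kap l i - pot G kap l i * (1 - pot G kap l i) / 4 := by
  set x := pot G kap l i with hx
  set s := pot G kap (l + 1) (splitEquiv l (i, 0)) + pot G kap (l + 1) (splitEquiv l (i, 1))
  have h0 : 0 ≤ x := pot_kap_nonneg hG l i
  have h1 : x ≤ 1 := pot_kap_le_one hG l i
  -- On `[0, 1]` the map `x ↦ 2x - x(1 - x)/4` has slope at most `9/4 < 3`, so replacing `kap L` by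
  -- the infimum `x` costs at most `3 (kap L - x)`. In this form the bound passes to the infimum
  -- over `L`.
  have key : (s - (2 * x - x * (1 - x) / 4)) / 3 + x ≤ pot G kap l i := by
    refine le_pot hG fun L hL hGL => ?_
    have h := (pot_children_le hG (fun L _ => (kap_pos L).le) hL hGL).trans (kap_children hL)
    have hle : x ≤ kap L := pot_le (fun L _ => (kap_pos L).le) hL hGL
    have := kap_le_one L
    change s ≤ _ at h
    nlinarith [mul_nonneg (sub_nonneg.2 hle) (sub_nonneg.2 this)]
  rw [← hx] at key
  linarith

lemma levelMean_pot_kap_succ (hG : ExponentTree G) (l : ℕ) :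
    levelMean (l + 1) (pot G kap (l + 1)) ≤ levelMean l (pot G kap l) -
      levelMean l (fun i => pot G kap l i * (1 - pot G kap l i)) / 8 := by
  rw [levelMean_succ, div_eq_inv_mul, ← levelMean_const_mul, ← levelMean_sub]
  refine levelMean_mono fun i => ?_
  linarith [pot_kap_children_le hG l i]

lemma levelMean_pot_kap_mul_nonneg (hG : ExponentTree G) (l : ℕ) :
    0 ≤ levelMean l (fun i => pot G kap l i * (1 - pot G kap l i)) :=
  levelMean_nonneg fun i =>
    mul_nonneg (pot_kap_nonneg hG l i) (sub_nonneg.2 (pot_kap_le_one hG l i))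

lemma exists_tendsto_levelMean_pot_kap (hG : ExponentTree G) :
    ∃ x, (∀ l, x ≤ levelMean l (pot G kap l)) ∧
      Tendsto (fun l => levelMean l (pot G kap l)) atTop (𝓝 x) := by
  have ha : Antitone fun l => levelMean l (pot G kap l) := by
    refine antitone_nat_of_succ_le fun l => ?_
    linarith [levelMean_pot_kap_succ hG l, levelMean_pot_kap_mul_nonneg hG l]
  have hb : BddBelow (Set.range fun l => levelMean l (pot G kap l)) :=
    ⟨0, by rintro _ ⟨l, rfl⟩; exact levelMean_nonneg (pot_kap_nonneg hG l)⟩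
  exact ⟨_, fun l => ciInf_le hb l, tendsto_atTop_ciInf ha hb⟩

/-- Polarization: the potential concentrates at `0` and `1`. -/
lemma tendsto_levelMean_pot_kap_mul (hG : ExponentTree G) :
    Tendsto (fun l => levelMean l (fun i => pot G kap l i * (1 - pot G kap l i))) atTop (𝓝 0) := by
  obtain ⟨x, -, hx⟩ := exists_tendsto_levelMean_pot_kap hG
  have h := ((hx.sub (hx.comp (tendsto_add_atTop_nat 1))).const_mul 8)
  simp only [sub_self, mul_zero] at h
  refine squeeze_zero (levelMean_pot_kap_mul_nonneg hG) (fun l => ?_) h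
  have := levelMean_pot_kap_succ hG l
  simp only [Function.comp]
  linarith

/-! ### The rate of polarization -/

/-- A choice of exponent `s` for which `L ↦ L ^ (-s)` contracts along the tree. -/
lemma exists_contraction_exponent {β : ℝ} (hβ : β < 1 / 2) :
    ∃ s e : ℝ, 0 < s ∧ s ≤ 1 ∧ 0 < e ∧
      (2 : ℝ) ^ (β * s) * (((2 : ℝ) ^ (-s) + 1 + e) / 2) < 1 := by
  -- The product equals `1` at `s = 0`, and its derivative there is negative exactly when `β < 1/2`.
  -- This is where the threshold enters.
  have hd : HasDerivAt (fun s : ℝ => (2 : ℝ) ^ (β * s) * (((2 : ℝ) ^ (-s) + 1) / 2))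
      (Real.log 2 * (β - 1 / 2)) 0 := by
    have h1 : HasDerivAt (fun s : ℝ => (2 : ℝ) ^ (β * s)) (Real.log 2 * β) 0 := by
      have := ((hasDerivAt_id (0 : ℝ)).const_mul β).const_rpow (a := 2) (by norm_num)
      simpa using this
    have h2 : HasDerivAt (fun s : ℝ => (2 : ℝ) ^ (-s)) (-Real.log 2) 0 := by
      have := ((hasDerivAt_id (0 : ℝ)).neg).const_rpow (a := 2) (by norm_num)
      simpa using this
    refine (h1.mul ((h2.add_const 1).div_const 2)).congr_deriv ?_
    norm_num
    ring
  have hneg : Real.log 2 * (β - 1 / 2) < 0 :=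
    mul_neg_of_pos_of_neg (Real.log_pos (by norm_num)) (by linarith)
  have hev : ∀ᶠ s in 𝓝[>] (0 : ℝ), (2 : ℝ) ^ (β * s) * (((2 : ℝ) ^ (-s) + 1) / 2) < 1 := by
    have h := (hasDerivAt_iff_tendsto_slope.1 hd).eventually (gt_mem_nhds hneg)
    have h' : ∀ᶠ s in 𝓝[>] (0 : ℝ), slope (fun s : ℝ => (2 : ℝ) ^ (β * s) *
        (((2 : ℝ) ^ (-s) + 1) / 2)) 0 s < 0 :=
      h.filter_mono (nhdsWithin_mono _ fun y hy => ne_of_gt hy)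
    filter_upwards [h', self_mem_nhdsWithin] with s hs hs0
    rw [slope_def_field, div_neg_iff] at hs
    have hs0 : 0 < s := hs0
    rcases hs with hs | hs
    · linarith [hs.2]
    · have := hs.1
      norm_num at this
      linarith
  obtain ⟨s, hs, hs0, hs1⟩ := (hev.and (Ioc_mem_nhdsGT (zero_lt_one (α := ℝ)))).exists
  have hc : ContinuousAt (fun e : ℝ => (2 : ℝ) ^ (β * s) * (((2 : ℝ) ^ (-s) + 1 + e) / 2)) 0 := by
    fun_prop
  have he : ∀ᶠ e in 𝓝[>] (0 : ℝ), (2 : ℝ) ^ (β * s) * (((2 : ℝ) ^ (-s) + 1 + e) / 2) < 1 :=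
    (hc.eventually (gt_mem_nhds (by simpa using hs))).filter_mono nhdsWithin_le_nhds
  obtain ⟨e, he, he0⟩ := (he.and self_mem_nhdsWithin).exists
  exact ⟨s, e, hs0, hs1, he0, he⟩

/-- The slack `e` pays for the minus step: `L / (L - 1) ≤ 1 + e` once `L ≥ 1 + 1 / e`, and `s ≤ 1`
keeps the `s`-th power below `1 + e`. -/
lemma rpow_neg_children_le {s e L : ℝ} (hs1 : s ≤ 1) (he : 0 < e)
    (hL : 1 + 1 / e ≤ L) :
    (L - 1) ^ (-s) + (2 * L) ^ (-s) ≤ ((2 : ℝ) ^ (-s) + 1 + e) * L ^ (-s) := by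
  have he' : 0 < 1 / e := by positivity
  have hL0 : 0 < L := by linarith
  have hL1 : 0 < L - 1 := by linarith
  rw [Real.mul_rpow (by norm_num) hL0.le]
  have hr : L / (L - 1) ≤ 1 + e := by
    rw [div_le_iff₀ hL1]
    have : 1 ≤ e * (L - 1) := by
      calc (1 : ℝ) = e * (1 / e) := by field_simp
        _ ≤ e * (L - 1) := by gcongr; linarith
    linarith
  have h1 : (L / (L - 1)) ^ s ≤ 1 + e := by
    refine le_trans ?_ hr
    conv_rhs => rw [← Real.rpow_one (L / (L - 1))]
    exact Real.rpow_le_rpow_of_exponent_le ((one_le_div hL1).2 (by linarith)) hs1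
  have h2 : (L - 1) ^ (-s) = (L / (L - 1)) ^ s * L ^ (-s) := by
    rw [Real.div_rpow hL0.le hL1.le, Real.rpow_neg hL1.le, Real.rpow_neg hL0.le]
    have := (Real.rpow_pos_of_pos hL0 s).ne'
    field_simp
  rw [h2]
  nlinarith [Real.rpow_pos_of_pos hL0 (-s)]

/-- The potential which controls the probability of falling short of an exponent. -/
noncomputable def ratePot (A ρ Λ s : ℝ) (j : ℕ) (L : ℝ) : ℝ :=
  min 1 (A * ρ ^ j * L ^ (-s) + kap L / kap Λ)

lemma ratePot_nonneg {A ρ Λ s : ℝ} (hA : 0 ≤ A) (hρ : 0 ≤ ρ) (j : ℕ) {L : ℝ} (hL : 0 ≤ L) :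
    0 ≤ ratePot A ρ Λ s j L :=
  le_min zero_le_one (add_nonneg (mul_nonneg (mul_nonneg hA (pow_nonneg hρ _))
    (Real.rpow_nonneg hL _)) (div_nonneg (kap_pos _).le (kap_pos _).le))

/-- If the minimum on the right is `1`, truncation at `1` settles the claim. Otherwise `kap L < kap
Λ` forces `L ≥ Λ`, where the power term contracts by `ρ` and the `kap` term does not grow on
average. The `kap` term thus plays the role of a maximal inequality for paths that drop below `Λ`.
-/
lemma ratePot_children {A e s L : ℝ} (hA : 0 ≤ A) (hs1 : s ≤ 1) (he : 0 < e) (j : ℕ) (hL : 0 ≤ L) :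
    ratePot A (((2 : ℝ) ^ (-s) + 1 + e) / 2) (1 + 1 / e) s j (max (L - 1) 0) +
        ratePot A (((2 : ℝ) ^ (-s) + 1 + e) / 2) (1 + 1 / e) s j (2 * L) ≤
      2 * ratePot A (((2 : ℝ) ^ (-s) + 1 + e) / 2) (1 + 1 / e) s (j + 1) L := by
  set ρ := ((2 : ℝ) ^ (-s) + 1 + e) / 2 with hρ
  set Λ := 1 + 1 / e
  have hρ0 : 0 ≤ ρ := by positivity
  have hΛ : 0 < kap Λ := kap_pos Λ
  by_cases h1 : 1 ≤ A * ρ ^ (j + 1) * L ^ (-s) + kap L / kap Λ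
  · have : ratePot A ρ Λ s (j + 1) L = 1 := min_eq_left h1
    rw [this]
    have := min_le_left 1 (A * ρ ^ j * (max (L - 1) 0) ^ (-s) + kap (max (L - 1) 0) / kap Λ)
    have := min_le_left 1 (A * ρ ^ j * (2 * L) ^ (-s) + kap (2 * L) / kap Λ)
    unfold ratePot
    linarith
  · have hΛL : Λ ≤ L := by
      by_contra! h
      have h2 : 1 ≤ kap L / kap Λ := (one_le_div hΛ).2 (kap_anti hL h.le)
      have h3 : 0 ≤ A * ρ ^ (j + 1) * L ^ (-s) := by positivity
      linarith
    have hm : max (L - 1) 0 = L - 1 := by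
      refine max_eq_left ?_
      have : 0 < 1 / e := by positivity
      simp only [Λ] at hΛL
      linarith
    have hR : ratePot A ρ Λ s (j + 1) L = A * ρ ^ (j + 1) * L ^ (-s) + kap L / kap Λ :=
      min_eq_right (not_le.1 h1).le
    have hk : kap (max (L - 1) 0) / kap Λ + kap (2 * L) / kap Λ ≤ 2 * (kap L / kap Λ) := by
      rw [← add_div, ← mul_div_assoc]
      gcongr
      have := mul_nonneg (kap_pos L).le (sub_nonneg.2 (kap_le_one L))
      linarith [kap_children hL]
    rw [hR]
    have h2 := min_le_right 1 (A * ρ ^ j * (max (L - 1) 0) ^ (-s) + kap (max (L - 1) 0) / kap Λ)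
    have h3 := min_le_right 1 (A * ρ ^ j * (2 * L) ^ (-s) + kap (2 * L) / kap Λ)
    have h4 := mul_le_mul_of_nonneg_left (rpow_neg_children_le hs1 he hΛL)
      (by positivity : 0 ≤ A * ρ ^ j)
    have h5 : (2 : ℝ) ^ (-s) + 1 + e = 2 * ρ := by rw [hρ]; ring
    rw [h5, ← hm] at h4
    unfold ratePot
    rw [pow_succ]
    linarith

/-- Going back one level costs one factor `ρ`, recorded by raising the index of the potential by
one. -/
lemma levelMean_pot_ratePot_le (hG : ExponentTree G) {A e s : ℝ} (hA : 0 ≤ A) (hs1 : s ≤ 1)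
    (he : 0 < e) (k j i : ℕ) :
    levelMean (k + j) (pot G (ratePot A (((2 : ℝ) ^ (-s) + 1 + e) / 2) (1 + 1 / e) s i) (k + j)) ≤
      levelMean k (pot G (ratePot A (((2 : ℝ) ^ (-s) + 1 + e) / 2) (1 + 1 / e) s (i + j)) k) := by
  induction j generalizing i with
  | zero => exact le_rfl
  | succ j ih =>
    refine le_trans ?_ ((ih (i + 1)).trans (by rw [show i + 1 + j = i + (j + 1) by lia]))
    rw [← add_assoc, levelMean_succ]
    refine levelMean_mono fun n => le_pot hG fun L hL h => ?_
    have h1 := pot_children_le hG (fun L hL => ratePot_nonneg hA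
      (by positivity : (0 : ℝ) ≤ ((2 : ℝ) ^ (-s) + 1 + e) / 2) (Λ := 1 + 1 / e) (s := s) i hL) hL h
    have h2 := ratePot_children hA hs1 he i hL
    linarith

lemma indicator_le_pot_ratePot (hG : ExponentTree G) {ρ Λ s T : ℝ} (hs : 0 ≤ s) (hT : 0 < T)
    (hΛ : 0 < Λ) (l : ℕ) (i : Fin (2 ^ l)) :
    Set.indicator {i | ¬ G l i T} 1 i ≤ pot G (ratePot (T ^ s) ρ Λ s 0) l i := by
  refine le_pot hG fun L hL h => ?_
  have hA : 0 < T ^ s := Real.rpow_pos_of_pos hT s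
  by_cases hi : G l i T
  · rw [Set.indicator_of_notMem (by simpa using hi)]
    exact le_min zero_le_one (add_nonneg (by positivity) (div_nonneg (kap_pos _).le (kap_pos _).le))
  · rw [Set.indicator_of_mem (by simpa using hi)]
    have hLT : L < T := by
      by_contra! h'
      exact hi (hG.anti _ _ _ _ h' h)
    refine le_min le_rfl ?_
    -- At `L = 0` the power does not blow up (`0 ^ (-s)` is `0` for `s > 0` by convention), so the
    -- `kap` term has to reach `1` there.
    rcases hL.eq_or_lt with rfl | hL
    · have : 1 ≤ kap 0 / kap Λ := (one_le_div (kap_pos _)).2 (kap_anti le_rfl hΛ.le)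
      have h0 : (0 : ℝ) ≤ T ^ s * ρ ^ 0 * 0 ^ (-s) := by positivity
      simpa using by linarith
    · have h1 : 1 ≤ T ^ s * L ^ (-s) := by
        rw [Real.rpow_neg hL.le, ← div_eq_mul_inv, one_le_div (Real.rpow_pos_of_pos hL s)]
        exact Real.rpow_le_rpow hL.le hLT.le hs
      have := div_nonneg (kap_pos L).le (kap_pos Λ).le
      simpa using by linarith

/-- Evaluation at the starting level, by the size `p` of the potential. If `p > η`, the trivial
bound `1` is at most `p + η⁻¹ p (1 - p)`. If `p ≤ η`, some admissible `L` is so large that both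
terms of `ratePot` are small. -/
lemma pot_ratePot_le (hG : ExponentTree G) {A ρ Λ s η : ℝ} (hA : 0 ≤ A) (hρ : 0 ≤ ρ) (hs : 0 ≤ s)
    (hη : 0 < η) (hη1 : η ≤ 1 / 4) (j l : ℕ) (i : Fin (2 ^ l)) :
    pot G (ratePot A ρ Λ s j) l i ≤
      pot G kap l i + η⁻¹ * (pot G kap l i * (1 - pot G kap l i)) + (A * ρ ^ j + 2 * η / kap Λ) := by
  have h0 := pot_kap_nonneg hG l i
  have h1 := sub_nonneg.2 (pot_kap_le_one hG l i)
  have hc : 0 ≤ A * ρ ^ j + 2 * η / kap Λ :=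
    add_nonneg (by positivity) (div_nonneg (by positivity) (kap_pos _).le)
  have hψ : ∀ L, 0 ≤ L → 0 ≤ ratePot A ρ Λ s j L := fun L hL => ratePot_nonneg hA hρ j hL
  rcases lt_or_ge η (pot G kap l i) with h | h
  · have h2 : pot G (ratePot A ρ Λ s j) l i ≤ 1 :=
      (pot_le hψ le_rfl (hG.zero l i)).trans (min_le_left _ _)
    have h3 : 1 ≤ η⁻¹ * pot G kap l i := by
      rw [inv_mul_eq_div, one_le_div hη]; exact h.le
    nlinarith [mul_le_mul_of_nonneg_right h3 h1]
  · obtain ⟨L, hL, hGL, hk⟩ := exists_lt_of_pot_lt hG (h.trans_lt (by linarith : η < 2 * η))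
    -- Here `kap L < 2 * η ≤ 1 / 2`, which is below `kap 1 = 10 / 11`.
    have hL1 : 1 ≤ L := by
      by_contra! hlt
      have := kap_anti hL hlt.le
      have e : kap 1 = 10 / 11 := by norm_num [kap]
      linarith
    have h2 : pot G (ratePot A ρ Λ s j) l i ≤ A * ρ ^ j + 2 * η / kap Λ := by
      refine (pot_le hψ hL hGL).trans ((min_le_right _ _).trans (add_le_add ?_ ?_))
      · refine mul_le_of_le_one_right (by positivity) ?_
        exact Real.rpow_le_one_of_one_le_of_nonpos hL1 (by linarith)
      · exact div_le_div_of_nonneg_right hk.le (kap_pos _).le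
    have : 0 ≤ η⁻¹ * (pot G kap l i * (1 - pot G kap l i)) := by positivity
    linarith

lemma pot_kap_sub_le_indicator (hG : ExponentTree G) {L₀ : ℝ} (hL₀ : 0 < L₀) (l : ℕ)
    (i : Fin (2 ^ l)) :
    pot G kap l i - (1 - kap L₀)⁻¹ * (pot G kap l i * (1 - pot G kap l i)) ≤
      Set.indicator {i | ¬ G l i L₀} 1 i := by
  have h0 := pot_kap_nonneg hG l i
  have h1 := sub_nonneg.2 (pot_kap_le_one hG l i)
  have hk : 0 < 1 - kap L₀ := sub_pos.2 (kap_lt_one hL₀)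
  by_cases hi : G l i L₀
  · rw [Set.indicator_of_notMem (by simpa using hi)]
    have h2 : pot G kap l i ≤ kap L₀ := pot_le (fun L _ => (kap_pos L).le) hL₀.le hi
    have h3 : 1 ≤ (1 - kap L₀)⁻¹ * (1 - pot G kap l i) := by
      rw [inv_mul_eq_div, one_le_div hk]; linarith
    nlinarith [mul_le_mul_of_nonneg_right h3 h0]
  · rw [Set.indicator_of_mem (by simpa using hi)]
    have : 0 ≤ (1 - kap L₀)⁻¹ * (pot G kap l i * (1 - pot G kap l i)) := by positivity
    simp only [Pi.one_apply]
    linarith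

/-- As `L₀ ≤ T`, the fraction is that of nodes missing `T` minus that of nodes missing `L₀`. The
former is at most the mean potential at level `k` plus errors, the latter at least the mean
potential at level `k + j` minus an error. The two means have the same limit, so they cancel
asymptotically. -/
lemma fraction_le (hG : ExponentTree G) {L₀ T e s η : ℝ} (hL₀ : 0 < L₀) (hT : L₀ ≤ T)
    (hs : 0 ≤ s) (hs1 : s ≤ 1) (he : 0 < e) (hη : 0 < η) (hη1 : η ≤ 1 / 4) (k j : ℕ) :
    ({i | G (k + j) i L₀ ∧ ¬ G (k + j) i T}.ncard : ℝ) / 2 ^ (k + j) ≤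
      (levelMean k (pot G kap k) +
        η⁻¹ * levelMean k (fun i => pot G kap k i * (1 - pot G kap k i)) +
        (T ^ s * (((2 : ℝ) ^ (-s) + 1 + e) / 2) ^ j + 2 * η / kap (1 + 1 / e))) -
      (levelMean (k + j) (pot G kap (k + j)) - (1 - kap L₀)⁻¹ *
        levelMean (k + j) (fun i => pot G kap (k + j) i * (1 - pot G kap (k + j) i))) := by
  have hA : 0 ≤ T ^ s := Real.rpow_nonneg (hL₀.le.trans hT) s
  have hρ : (0 : ℝ) ≤ ((2 : ℝ) ^ (-s) + 1 + e) / 2 := by positivity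
  have h1 : levelMean (k + j) (Set.indicator {i | ¬ G (k + j) i T} 1) ≤
      levelMean k (pot G kap k) +
        η⁻¹ * levelMean k (fun i => pot G kap k i * (1 - pot G kap k i)) +
        (T ^ s * (((2 : ℝ) ^ (-s) + 1 + e) / 2) ^ j + 2 * η / kap (1 + 1 / e)) := by
    refine (levelMean_mono fun i => indicator_le_pot_ratePot hG hs (hL₀.trans_le hT)
      (by positivity : 0 < 1 + 1 / e) _ i).trans
      ((levelMean_pot_ratePot_le hG hA hs1 he k j 0).trans ?_)
    rw [zero_add]
    refine (levelMean_mono fun i => pot_ratePot_le hG hA hρ hs hη hη1 j k i).trans ?_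
    rw [levelMean_add, levelMean_const, levelMean_add, levelMean_const_mul]
  have h2 : levelMean (k + j) (pot G kap (k + j)) - (1 - kap L₀)⁻¹ *
        levelMean (k + j) (fun i => pot G kap (k + j) i * (1 - pot G kap (k + j) i)) ≤
      levelMean (k + j) (Set.indicator {i | ¬ G (k + j) i L₀} 1) := by
    rw [← levelMean_const_mul, ← levelMean_sub]
    exact levelMean_mono fun i => pot_kap_sub_le_indicator hG hL₀ _ i
  rw [← levelMean_indicator]
  refine le_trans (le_of_eq ?_) (sub_le_sub h1 h2)
  rw [← levelMean_sub]
  congr 1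
  funext i
  by_cases hb : G (k + j) i T
  · have ha := hG.anti _ _ _ _ hT hb
    simp [Set.indicator, ha, hb]
  · by_cases ha : G (k + j) i L₀ <;> simp [Set.indicator, ha, hb]

/-- The rate of polarization: almost all nodes with a nontrivial exponent have an exponent which
is at least `2 ^ (β l)`. -/
theorem tendsto_fraction (hG : ExponentTree G) {L₀ β : ℝ} (hL₀ : 0 < L₀) (hβ0 : 0 < β)
    (hβ : β < 1 / 2) :
    Tendsto (fun l : ℕ => ({i | G l i L₀ ∧ ¬ G l i ((2 : ℝ) ^ (β * l))}.ncard : ℝ) / 2 ^ l)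
      atTop (𝓝 0) := by
  obtain ⟨s, e, hs, hs1, he, hr⟩ := exists_contraction_exponent hβ
  obtain ⟨x, hx, hxlim⟩ := exists_tendsto_levelMean_pot_kap hG
  have helim := tendsto_levelMean_pot_kap_mul hG
  set ρ := ((2 : ℝ) ^ (-s) + 1 + e) / 2 with hρ
  have hρ0 : 0 < ρ := by positivity
  set E := fun l => levelMean l (fun i => pot G kap l i * (1 - pot G kap l i))
  rw [Metric.tendsto_atTop']
  intro ε hε
  have hΛ := kap_pos (1 + 1 / e)
  -- Five errors of size `ε / 5` are allotted: `η` is fixed first, then `k` depending on `η`, and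
  -- then `l` grows with `k` fixed.
  set η := min (1 / 4) (ε * kap (1 + 1 / e) / 10) with hηdef
  have hη : 0 < η := lt_min (by norm_num) (by positivity)
  have hη2 : 2 * η / kap (1 + 1 / e) ≤ ε / 5 := by
    rw [div_le_iff₀ hΛ]
    have : η ≤ ε * kap (1 + 1 / e) / 10 := min_le_right _ _
    linarith
  have hk1 : ∀ᶠ k in atTop, levelMean k (pot G kap k) < x + ε / 5 :=
    hxlim.eventually (gt_mem_nhds (by linarith))
  have hk2 : ∀ᶠ k in atTop, η⁻¹ * E k < ε / 5 :=
    (helim.const_mul η⁻¹).eventually (gt_mem_nhds (by rw [mul_zero]; positivity))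
  obtain ⟨k, hk1, hk2⟩ := (hk1.and hk2).exists
  have hl1 : ∀ᶠ l in atTop, (1 - kap L₀)⁻¹ * E l < ε / 5 :=
    (helim.const_mul _).eventually (gt_mem_nhds (by rw [mul_zero]; positivity))
  have hl2 : ∀ᶠ l : ℕ in atTop, ((2 : ℝ) ^ (β * s) * ρ) ^ l * (ρ ^ k)⁻¹ < ε / 5 := by
    have := (tendsto_pow_atTop_nhds_zero_of_lt_one (by positivity) hr).mul_const (ρ ^ k)⁻¹
    exact this.eventually (gt_mem_nhds (by rw [zero_mul]; positivity))
  have hl3 : ∀ᶠ l : ℕ in atTop, L₀ ≤ (2 : ℝ) ^ (β * l) := by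
    have h1 : Tendsto (fun l : ℕ => ((2 : ℝ) ^ β) ^ l) atTop atTop :=
      tendsto_pow_atTop_atTop_of_one_lt (Real.one_lt_rpow (by norm_num) hβ0)
    filter_upwards [h1.eventually_ge_atTop L₀] with l hl
    rwa [Real.rpow_mul (by norm_num), Real.rpow_natCast]
  obtain ⟨N, hN⟩ := eventually_atTop.1 (hl1.and (hl2.and hl3))
  refine ⟨max N k, fun l hl => ?_⟩
  obtain ⟨h1, h2, h3⟩ := hN l ((le_max_left _ _).trans hl.le)
  obtain ⟨j, rfl⟩ := Nat.exists_eq_add_of_le ((le_max_right N k).trans hl.le)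
  have hf := fraction_le hG hL₀ h3 hs.le hs1 he hη (min_le_left _ _) k j
  -- The contraction acts only on the last `j = l - k` levels; the missing `k` factors give the
  -- constant `(ρ ^ k)⁻¹`.
  have hT : ((2 : ℝ) ^ (β * ((k + j : ℕ) : ℝ))) ^ s * ρ ^ j =
      ((2 : ℝ) ^ (β * s) * ρ) ^ (k + j) * (ρ ^ k)⁻¹ := by
    rw [mul_pow, pow_add ρ, ← Real.rpow_natCast ((2 : ℝ) ^ (β * s)),
      ← Real.rpow_mul (by norm_num), ← Real.rpow_mul (by norm_num), mul_right_comm]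
    field_simp
  rw [← hρ, hT] at hf
  rw [dist_zero_right, Real.norm_of_nonneg (by positivity)]
  have hxl := hx (k + j)
  simp only [E] at h1 h2 hk2
  linarith

end Tree

/-! ### One step of the polar transform -/

lemma splitEquiv_val (l : ℕ) (i : Fin (2 ^ l)) (b : Fin 2) :
    (splitEquiv l (i, b) : ℕ) = b + 2 * i := rfl

lemma splitEquiv_lt {l : ℕ} {i j : Fin (2 ^ l)} (h : j < i) (b c : Fin 2) :
    splitEquiv l (j, b) < splitEquiv l (i, c) := by
  rw [Fin.lt_def, splitEquiv_val, splitEquiv_val]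
  have := Fin.lt_def.1 h
  lia

lemma splitEquiv_zero_lt_one {l : ℕ} (i : Fin (2 ^ l)) :
    splitEquiv l (i, 0) < splitEquiv l (i, 1) := by
  rw [Fin.lt_def, splitEquiv_val, splitEquiv_val]
  simp

lemma inputs_add_self {m : ℕ} (x : Inputs m) : x + x = 0 := by
  ext k; exact CharTwo.add_self_eq_zero _

/-- Interleaving of two families according to the final bit of the index. -/
def interleave {α : Type*} (l : ℕ) (v w : Fin (2 ^ l) → α) (n : Fin (2 ^ (l + 1))) : α :=
  if ((splitEquiv l).symm n).2 = 0 then v ((splitEquiv l).symm n).1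
  else w ((splitEquiv l).symm n).1

@[simp]
lemma interleave_zero {α : Type*} (l : ℕ) (v w : Fin (2 ^ l) → α) (i : Fin (2 ^ l)) :
    interleave l v w (splitEquiv l (i, 0)) = v i := by simp [interleave]

@[simp]
lemma interleave_one {α : Type*} (l : ℕ) (v w : Fin (2 ^ l) → α) (i : Fin (2 ^ l)) :
    interleave l v w (splitEquiv l (i, 1)) = w i := by simp [interleave]

lemma splitEquiv_forall {l : ℕ} {p : Fin (2 ^ (l + 1)) → Prop}
    (h0 : ∀ i, p (splitEquiv l (i, 0))) (h1 : ∀ i, p (splitEquiv l (i, 1))) (n) : p n := by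
  obtain ⟨⟨i, b⟩, rfl⟩ := (splitEquiv l).surjective n
  fin_cases b
  exacts [h0 i, h1 i]

/-- The inputs of level `l + 1` in terms of the inputs of the two copies of level `l`. -/
def combineEquiv (m l : ℕ) : (Fin (2 ^ l) → Inputs m) × (Fin (2 ^ l) → Inputs m) ≃
    (Fin (2 ^ (l + 1)) → Inputs m) where
  toFun p := interleave l (p.1 + p.2) p.2
  invFun u := (fun j => u (splitEquiv l (j, 0)) + u (splitEquiv l (j, 1)),
    fun j => u (splitEquiv l (j, 1)))
  left_inv p := by
    ext1
    · funext j
      simp [add_assoc, inputs_add_self]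
    · funext j
      simp
  right_inv u := by
    funext n
    revert n
    refine splitEquiv_forall (fun i => ?_) (fun i => ?_)
    · simp [add_assoc, inputs_add_self]
    · simp

/-- The kernel is the last Kronecker factor, hence acts on the final bit of the index: it mixes
neighbours `2i, 2i + 1` before two separate encodings of level `l`. -/
lemma encode_succ {m l : ℕ} (u : Fin (2 ^ (l + 1)) → Inputs m) (j : Fin (2 ^ l)) (c : Fin 2) :
    encode (l + 1) u (splitEquiv l (j, c)) =
      encode l (fun i => ∑ b, kernelMatrix b c • u (splitEquiv l (i, b))) j := by
  funext k
  simp only [encode, Matrix.vecMul, dotProduct]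
  rw [← (splitEquiv l).sum_comp, Fintype.sum_prod_type]
  refine Finset.sum_congr rfl fun i _ => ?_
  simp only [Finset.sum_apply, Pi.smul_apply, smul_eq_mul, Finset.sum_mul]
  refine Finset.sum_congr rfl fun b _ => ?_
  have : polarMatrix (l + 1) (splitEquiv l (i, b)) (splitEquiv l (j, c)) =
      polarMatrix l i j * kernelMatrix b c := by
    change Matrix.reindex (splitEquiv l) (splitEquiv l) (polarMatrix l ⊗ₖ kernelMatrix) _ _ = _
    simp [Matrix.kroneckerMap_apply]
  rw [this]
  ring

lemma encode_combine_zero {m l : ℕ} (v w : Fin (2 ^ l) → Inputs m) (j : Fin (2 ^ l)) :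
    encode (l + 1) (combineEquiv m l (v, w)) (splitEquiv l (j, 0)) = encode l v j := by
  rw [encode_succ]
  congr 1
  funext i
  simp [kernelMatrix, combineEquiv, add_assoc, inputs_add_self]

lemma encode_combine_one {m l : ℕ} (v w : Fin (2 ^ l) → Inputs m) (j : Fin (2 ^ l)) :
    encode (l + 1) (combineEquiv m l (v, w)) (splitEquiv l (j, 1)) = encode l w j := by
  rw [encode_succ]
  congr 1
  funext i
  simp [kernelMatrix, combineEquiv]

/-! ### Synthesized channels of level `l + 1` as transforms of two copies of level `l`. -/

section Measure

variable {m : ℕ} {Y : Type*} [MeasurableSpace Y]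

lemma measurable_interleave (l : ℕ) :
    Measurable fun p : (Fin (2 ^ l) → Y) × (Fin (2 ^ l) → Y) => interleave l p.1 p.2 := by
  refine measurable_pi_lambda _ fun n => ?_
  unfold interleave
  split_ifs <;> fun_prop

lemma map_interleave_pi (l : ℕ) (ν : Fin (2 ^ (l + 1)) → Measure Y)
    [∀ n, IsProbabilityMeasure (ν n)] :
    ((Measure.pi fun j => ν (splitEquiv l (j, 0))).prod
      (Measure.pi fun j => ν (splitEquiv l (j, 1)))).map (fun p => interleave l p.1 p.2) =
      Measure.pi ν := by
  symm
  refine Measure.pi_eq fun s hs => ?_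
  rw [Measure.map_apply (measurable_interleave l) (MeasurableSet.univ_pi hs)]
  have : (fun p : (Fin (2 ^ l) → Y) × (Fin (2 ^ l) → Y) => interleave l p.1 p.2) ⁻¹'
      Set.univ.pi s = (Set.univ.pi fun j => s (splitEquiv l (j, 0))) ×ˢ
        (Set.univ.pi fun j => s (splitEquiv l (j, 1))) := by
    ext p
    simp only [Set.mem_preimage, Set.mem_univ_pi, Set.mem_prod]
    constructor
    · exact fun h => ⟨fun j => by simpa using h (splitEquiv l (j, 0)),
        fun j => by simpa using h (splitEquiv l (j, 1))⟩
    · rintro ⟨h0, h1⟩ n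
      revert n
      exact splitEquiv_forall (fun i => by simpa using h0 i) (fun i => by simpa using h1 i)
  rw [this, Measure.prod_prod, Measure.pi_pi, Measure.pi_pi, ← (splitEquiv l).prod_comp,
    Fintype.prod_prod_type, ← Finset.prod_mul_distrib]
  simp

lemma lintegral_synthChannel (P : Inputs m → Measure Y) [∀ x, IsProbabilityMeasure (P x)] (l : ℕ)
    (i : Fin (2 ^ l)) (a : Inputs m)
    {F : (Fin (2 ^ l) → Y) × (Set.Iio i → Inputs m) → ℝ≥0∞} (hF : Measurable F) :
    ∫⁻ o, F o ∂synthChannel P l i a =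
      ∑ u : Fin (2 ^ l) → Inputs m, if u i = a then ((2 ^ m : ℝ≥0∞) ^ (2 ^ l - 1))⁻¹ *
        ∫⁻ y, F (y, fun j => u j) ∂Measure.pi (fun j => P (encode l u j)) else 0 := by
  rw [synthChannel, lintegral_finsetSum_measure, Finset.sum_filter]
  refine Finset.sum_congr rfl fun u _ => ?_
  congr 1
  rw [lintegral_smul_measure, lintegral_prod _ hF.aemeasurable, smul_eq_mul]
  congr 1
  refine lintegral_congr fun y => ?_
  rw [lintegral_dirac' _ (by fun_prop)]

/-- The outputs of the two copies of level `l`, as a function of the output of level `l + 1`. -/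
def unfoldOutput (m l : ℕ) (i : Fin (2 ^ l)) (c : Fin 2)
    (o : (Fin (2 ^ (l + 1)) → Y) × (Set.Iio (splitEquiv l (i, c)) → Inputs m)) :
    ((Fin (2 ^ l) → Y) × (Set.Iio i → Inputs m)) × ((Fin (2 ^ l) → Y) × (Set.Iio i → Inputs m)) :=
  ((fun j => o.1 (splitEquiv l (j, 0)),
      fun j => o.2 ⟨splitEquiv l (j, 0), Set.mem_Iio.2 (splitEquiv_lt j.2 _ _)⟩ +
        o.2 ⟨splitEquiv l (j, 1), Set.mem_Iio.2 (splitEquiv_lt j.2 _ _)⟩),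
    (fun j => o.1 (splitEquiv l (j, 1)), fun j => o.2 ⟨splitEquiv l (j, 1), Set.mem_Iio.2 (splitEquiv_lt j.2 _ _)⟩))

lemma measurable_unfoldOutput (l : ℕ) (i : Fin (2 ^ l)) (c : Fin 2) :
    Measurable (unfoldOutput (Y := Y) m l i c) := by
  unfold unfoldOutput
  refine Measurable.prodMk (Measurable.prodMk (by fun_prop) ?_) (by fun_prop)
  refine measurable_pi_lambda _ fun j => ?_
  have : Measurable fun p : Inputs m × Inputs m => p.1 + p.2 := measurable_of_countable _
  exact this.comp (f := fun o : (Fin (2 ^ (l + 1)) → Y) × (Set.Iio (splitEquiv l (i, c)) →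
    Inputs m) => (o.2 ⟨splitEquiv l (j, 0), Set.mem_Iio.2 (splitEquiv_lt j.2 _ _)⟩,
        o.2 ⟨splitEquiv l (j, 1), Set.mem_Iio.2 (splitEquiv_lt j.2 _ _)⟩)) (by fun_prop)

/-- The integral over the outputs of two copies of level `l`, given all the inputs. -/
noncomputable def pairIntegral (P : Inputs m → Measure Y) (l : ℕ) (i : Fin (2 ^ l))
    (F : ((Fin (2 ^ l) → Y) × (Set.Iio i → Inputs m)) ×
      ((Fin (2 ^ l) → Y) × (Set.Iio i → Inputs m)) → ℝ≥0∞)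
    (v w : Fin (2 ^ l) → Inputs m) : ℝ≥0∞ :=
  ∫⁻ y, ∫⁻ y', F ((y, fun j => v j), (y', fun j => w j))
    ∂Measure.pi (fun j => P (encode l w j)) ∂Measure.pi (fun j => P (encode l v j))

lemma lintegral_synthChannel_prod (P : Inputs m → Measure Y) [∀ x, IsProbabilityMeasure (P x)]
    (l : ℕ) (i : Fin (2 ^ l)) [∀ a, IsProbabilityMeasure (synthChannel P l i a)] (a b : Inputs m)
    {F : ((Fin (2 ^ l) → Y) × (Set.Iio i → Inputs m)) ×
      ((Fin (2 ^ l) → Y) × (Set.Iio i → Inputs m)) → ℝ≥0∞} (hF : Measurable F) :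
    ∫⁻ p, F p ∂((synthChannel P l i a).prod (synthChannel P l i b)) =
      ∑ v : Fin (2 ^ l) → Inputs m, ∑ w : Fin (2 ^ l) → Inputs m,
        if v i = a ∧ w i = b then
          ((2 ^ m : ℝ≥0∞) ^ (2 ^ l - 1))⁻¹ * ((2 ^ m : ℝ≥0∞) ^ (2 ^ l - 1))⁻¹ *
            pairIntegral P l i F v w else 0 := by
  rw [lintegral_prod _ hF.aemeasurable, lintegral_synthChannel _ _ _ _ hF.lintegral_prod_right']
  refine Finset.sum_congr rfl fun v _ => ?_
  by_cases hv : v i = a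
  swap; · simp [hv]
  simp only [hv, if_true, true_and]
  have h1 : ∀ y, ∫⁻ o', F ((y, fun j : Set.Iio i => v j), o') ∂synthChannel P l i b = _ :=
    fun y => lintegral_synthChannel P l i b (hF.comp (by fun_prop))
  simp_rw [h1]
  have hm : ∀ w : Fin (2 ^ l) → Inputs m, Measurable fun y => ∫⁻ y', F ((y, fun j => v j),
      (y', fun j => w j)) ∂Measure.pi (fun j => P (encode l w j)) := fun w =>
    (hF.comp (by fun_prop : Measurable fun q : (Fin (2 ^ l) → Y) × (Fin (2 ^ l) → Y) =>
      (((q.1, fun j : Set.Iio i => v j), (q.2, fun j : Set.Iio i => w j)) :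
        ((Fin (2 ^ l) → Y) × (Set.Iio i → Inputs m)) ×
      ((Fin (2 ^ l) → Y) × (Set.Iio i → Inputs m))))).lintegral_prod_right'
  rw [lintegral_finsetSum, Finset.mul_sum]
  · refine Finset.sum_congr rfl fun w _ => ?_
    split_ifs
    · rw [lintegral_const_mul _ (hm w), mul_assoc]
      rfl
    · simp
  · intro w _
    split_ifs
    · exact (hm w).const_mul _
    · exact measurable_const

lemma lintegral_pi_succ (P : Inputs m → Measure Y) [∀ x, IsProbabilityMeasure (P x)] (l : ℕ)
    (v w : Fin (2 ^ l) → Inputs m)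
    {H : (Fin (2 ^ l) → Y) × (Fin (2 ^ l) → Y) → ℝ≥0∞} (hH : Measurable H) :
    ∫⁻ y, H (fun j => y (splitEquiv l (j, 0)), fun j => y (splitEquiv l (j, 1)))
        ∂Measure.pi (fun n => P (encode (l + 1) (combineEquiv m l (v, w)) n)) =
      ∫⁻ y, ∫⁻ y', H (y, y') ∂Measure.pi (fun j => P (encode l w j))
        ∂Measure.pi (fun j => P (encode l v j)) := by
  have hH' : Measurable fun y : Fin (2 ^ (l + 1)) → Y =>
      H (fun j => y (splitEquiv l (j, 0)), fun j => y (splitEquiv l (j, 1))) :=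
    hH.comp (by fun_prop)
  rw [← map_interleave_pi, lintegral_map hH' (measurable_interleave l)]
  simp only [interleave_zero, interleave_one, encode_combine_zero, encode_combine_one]
  exact lintegral_prod _ hH.aemeasurable

/-- Beyond the `2 ^ l - 1` free inputs of each copy, one symbol of the pair at position `i` stays
free; it gives the average over one symbol in both transforms. -/
lemma synthChannel_const_succ (m l : ℕ) :
    ((2 ^ m : ℝ≥0∞) ^ (2 ^ (l + 1) - 1))⁻¹ = (2 ^ m : ℝ≥0∞)⁻¹ *
      (((2 ^ m : ℝ≥0∞) ^ (2 ^ l - 1))⁻¹ * ((2 ^ m : ℝ≥0∞) ^ (2 ^ l - 1))⁻¹) := by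
  have h : 2 ^ (l + 1) - 1 = 1 + ((2 ^ l - 1) + (2 ^ l - 1)) := by
    have := Nat.one_le_two_pow (n := l)
    rw [pow_succ]; lia
  rw [h, pow_add, pow_add, pow_one, ENNReal.mul_inv, ENNReal.mul_inv] <;> simp

lemma combineEquiv_zero {l : ℕ} (v w : Fin (2 ^ l) → Inputs m) (i : Fin (2 ^ l)) :
    combineEquiv m l (v, w) (splitEquiv l (i, 0)) = v i + w i := by simp [combineEquiv]

lemma combineEquiv_one {l : ℕ} (v w : Fin (2 ^ l) → Inputs m) (i : Fin (2 ^ l)) :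
    combineEquiv m l (v, w) (splitEquiv l (i, 1)) = w i := by simp [combineEquiv]

lemma inputs_add_eq_iff (x y z : Inputs m) : x + y = z ↔ x = z + y := by
  constructor <;> rintro rfl <;> simp [add_assoc, inputs_add_self]

/-- The even-indexed channels of level `l + 1`. -/
lemma lintegral_synthChannel_zero (P : Inputs m → Measure Y) [∀ x, IsProbabilityMeasure (P x)]
    (l : ℕ) (i : Fin (2 ^ l)) [∀ a, IsProbabilityMeasure (synthChannel P l i a)] (a : Inputs m)
    {F : ((Fin (2 ^ l) → Y) × (Set.Iio i → Inputs m)) ×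
      ((Fin (2 ^ l) → Y) × (Set.Iio i → Inputs m)) → ℝ≥0∞} (hF : Measurable F) :
    ∫⁻ o, F (unfoldOutput m l i 0 o) ∂synthChannel P (l + 1) (splitEquiv l (i, 0)) a =
      ∑ b, (2 ^ m : ℝ≥0∞)⁻¹ *
        ∫⁻ p, F p ∂((synthChannel P l i (a + b)).prod (synthChannel P l i b)) := by
  have hF' : Measurable fun o => F (unfoldOutput m l i 0 o) :=
    hF.comp (measurable_unfoldOutput l i 0)
  rw [lintegral_synthChannel _ _ _ _ hF', ← (combineEquiv m l).sum_comp, Fintype.sum_prod_type]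
  simp_rw [lintegral_synthChannel_prod P l i _ _ hF, Finset.mul_sum]
  conv_rhs => rw [Finset.sum_comm]
  refine Finset.sum_congr rfl fun v _ => ?_
  rw [Finset.sum_comm]
  refine Finset.sum_congr rfl fun w _ => ?_
  -- Once `v` and `w` are fixed, the averaged symbol can only be `w i`.
  rw [Finset.sum_eq_single (w i) (by intro b _ hb; simp [hb.symm]) (by simp)]
  simp only [combineEquiv_zero, inputs_add_eq_iff, and_true]
  split_ifs
  · rw [synthChannel_const_succ, mul_assoc]
    congr 2
    rw [pairIntegral, ← lintegral_pi_succ P l v w (H := fun q => F ((q.1, fun j => v j),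
      (q.2, fun j => w j))) (hF.comp (by fun_prop))]
    simp [unfoldOutput, combineEquiv_zero, combineEquiv_one, add_assoc, inputs_add_self]
  · simp

/-- The odd-indexed channels of level `l + 1`. -/
lemma lintegral_synthChannel_one (P : Inputs m → Measure Y) [∀ x, IsProbabilityMeasure (P x)]
    (l : ℕ) (i : Fin (2 ^ l)) [∀ a, IsProbabilityMeasure (synthChannel P l i a)] (b : Inputs m)
    {F : Inputs m → ((Fin (2 ^ l) → Y) × (Set.Iio i → Inputs m)) ×
      ((Fin (2 ^ l) → Y) × (Set.Iio i → Inputs m)) → ℝ≥0∞} (hF : ∀ a, Measurable (F a)) :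
    ∫⁻ o, F (o.2 ⟨splitEquiv l (i, 0), Set.mem_Iio.2 (splitEquiv_zero_lt_one i)⟩) (unfoldOutput m l i 1 o)
        ∂synthChannel P (l + 1) (splitEquiv l (i, 1)) b =
      ∑ a, (2 ^ m : ℝ≥0∞)⁻¹ *
        ∫⁻ p, F a p ∂((synthChannel P l i (a + b)).prod (synthChannel P l i b)) := by
  have hF' : Measurable fun q : Inputs m × _ => F q.1 q.2 := measurable_from_prod_countable_right hF
  have hF'' : Measurable fun o : (Fin (2 ^ (l + 1)) → Y) ×
      (Set.Iio (splitEquiv l (i, 1)) → Inputs m) =>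
      F (o.2 ⟨splitEquiv l (i, 0), Set.mem_Iio.2 (splitEquiv_zero_lt_one i)⟩)
        (unfoldOutput m l i 1 o) :=
    hF'.comp (Measurable.prodMk (by fun_prop) (measurable_unfoldOutput l i 1))
  rw [lintegral_synthChannel _ _ _ _ hF'', ← (combineEquiv m l).sum_comp, Fintype.sum_prod_type]
  simp_rw [fun a => lintegral_synthChannel_prod P l i (a + b) b (hF a), Finset.mul_sum]
  conv_rhs => rw [Finset.sum_comm]
  refine Finset.sum_congr rfl fun v _ => ?_
  rw [Finset.sum_comm]
  refine Finset.sum_congr rfl fun w _ => ?_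
  rw [Finset.sum_eq_single (v i + b) (by
    intro a _ ha
    rw [if_neg, mul_zero]
    rintro ⟨h, -⟩
    exact ha (by rw [h, add_assoc, inputs_add_self, add_zero])) (by simp)]
  simp only [combineEquiv_one, add_assoc, inputs_add_self, add_zero, true_and]
  split_ifs with h
  · subst h
    rw [synthChannel_const_succ, mul_assoc]
    congr 2
    rw [pairIntegral, ← lintegral_pi_succ P l v w (H := fun q => F (v i + w i) ((q.1, fun j => v j),
      (q.2, fun j => w j))) ((hF _).comp (by fun_prop))]
    simp [unfoldOutput, combineEquiv_zero, combineEquiv_one, add_assoc, inputs_add_self]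
  · simp

/-- The transform identities with constant integrand `1` carry total mass from level `l` to level `l
+ 1`. -/
instance isProbabilityMeasure_synthChannel (P : Inputs m → Measure Y)
    [∀ x, IsProbabilityMeasure (P x)] (l : ℕ) (i : Fin (2 ^ l)) (a : Inputs m) :
    IsProbabilityMeasure (synthChannel P l i a) := by
  induction l generalizing a with
  | zero =>
    constructor
    rw [← lintegral_one, lintegral_synthChannel _ _ _ _ measurable_const]
    rw [Finset.sum_eq_single fun _ => a]
    · simp
    · intro u _ hu
      rw [if_neg]
      rintro rfl
      exact hu (by funext j; rw [show j = i from Fin.ext (by have := j.2; have := i.2; lia)])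
    · simp
  | succ l ih =>
    have hc : (2 ^ m : ℝ≥0∞) * (2 ^ m : ℝ≥0∞)⁻¹ = 1 := ENNReal.mul_inv_cancel (by simp) (by simp)
    revert i
    refine splitEquiv_forall (fun i => ⟨?_⟩) (fun i => ⟨?_⟩)
    · rw [← lintegral_one]
      exact (lintegral_synthChannel_zero P l i a (F := fun _ => 1) measurable_const).trans
        (by simp [hc])
    · rw [← lintegral_one]
      exact (lintegral_synthChannel_one P l i a (F := fun _ _ => 1) fun _ => measurable_const).trans
        (by simp [hc])

end Measure

/-! ### Bounds on the Bhattacharyya parameter -/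

/-- A variational form of "the Bhattacharyya parameter of `Q` is at most `z`". -/
def BhattBound {Ω : Type*} [MeasurableSpace Ω] (Q : ZMod 2 → Measure Ω) (z : ℝ≥0∞) : Prop :=
  ∃ f : ZMod 2 → Ω → ℝ≥0∞, (∀ s, Measurable (f s)) ∧ (∀ y, 1 ≤ f 0 y * f 1 y) ∧
    ∀ s, ∫⁻ y, f s y ∂Q s ≤ z

lemma BhattBound.mono {Ω : Type*} [MeasurableSpace Ω] {Q : ZMod 2 → Measure Ω} {z z' : ℝ≥0∞}
    (h : BhattBound Q z) (hz : z ≤ z') : BhattBound Q z' := by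
  obtain ⟨f, hf, h1, h2⟩ := h
  exact ⟨f, hf, h1, fun s => (h2 s).trans hz⟩

lemma bhattBound_one {Ω : Type*} [MeasurableSpace Ω] (Q : ZMod 2 → Measure Ω)
    [∀ s, IsProbabilityMeasure (Q s)] : BhattBound Q 1 :=
  ⟨fun _ _ => 1, fun _ => measurable_const, fun _ => by simp, fun s => by simp⟩

/-- The parity of the inputs in `S`. -/
def parity {m : ℕ} (S : Finset (Fin m)) (x : Inputs m) : ZMod 2 := ∑ i ∈ S, x i

lemma parity_add {m : ℕ} (S : Finset (Fin m)) (x y : Inputs m) :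
    parity S (x + y) = parity S x + parity S y := by
  simp [parity, Finset.sum_add_distrib]

lemma zmod_two_eq (s : ZMod 2) : s = 0 ∨ s = 1 := by
  revert s; decide

lemma sum_zmod_two {M : Type*} [AddCommMonoid M] (f : ZMod 2 → M) : ∑ s, f s = f 0 + f 1 :=
  Fin.sum_univ_two f

section Parity

variable {m : ℕ} {Ω : Type*} [MeasurableSpace Ω]

lemma two_div_two_pow (m : ℕ) : (2 / 2 ^ m : ℝ≥0∞) = 2 * (2 ^ m)⁻¹ := div_eq_mul_inv _ _

lemma lintegral_parityChannel (W : Inputs m → Measure Ω) (S : Finset (Fin m)) (s : ZMod 2)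
    (F : Ω → ℝ≥0∞) :
    ∫⁻ y, F y ∂parityChannel W S s =
      ∑ x, if parity S x = s then 2 * (2 ^ m : ℝ≥0∞)⁻¹ * ∫⁻ y, F y ∂W x else 0 := by
  rw [parityChannel, lintegral_finsetSum_measure, Finset.sum_filter]
  simp only [lintegral_smul_measure, smul_eq_mul, two_div_two_pow]
  rfl

/-- Flipping one coordinate in `S` exchanges the two parity classes, so each carries half of the
inputs. -/
lemma sum_parity_eq {S : Finset (Fin m)} (hS : S.Nonempty) (s : ZMod 2) :
    ∑ x : Inputs m, (if parity S x = s then 2 * (2 ^ m : ℝ≥0∞)⁻¹ else 0) = 1 := by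
  obtain ⟨k, hk⟩ := hS
  have hp : parity S (Pi.single k 1) = 1 := by
    simp [parity, Pi.single_apply, hk]
  have hflip : ∀ s : ZMod 2, ∑ x : Inputs m, (if parity S x = s then 2 * (2 ^ m : ℝ≥0∞)⁻¹ else 0) =
      ∑ x : Inputs m, (if parity S x = s + 1 then 2 * (2 ^ m : ℝ≥0∞)⁻¹ else 0) := by
    intro s
    rw [← Equiv.sum_comp (Equiv.addRight (Pi.single k 1 : Inputs m))
      (fun x => if parity S x = s + 1 then 2 * (2 ^ m : ℝ≥0∞)⁻¹ else 0)]
    simp [parity_add, hp]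
  have htot : ∑ s : ZMod 2, ∑ x : Inputs m,
      (if parity S x = s then 2 * (2 ^ m : ℝ≥0∞)⁻¹ else 0) = 2 := by
    rw [Finset.sum_comm]
    have : (2 ^ m : ℝ≥0∞) * (2 * (2 ^ m)⁻¹) = 2 := by
      rw [mul_left_comm, ENNReal.mul_inv_cancel (by simp) (by simp), mul_one]
    simpa using this
  rw [sum_zmod_two] at htot
  have h01 := hflip 0
  rw [zero_add] at h01
  rw [h01, ← two_mul] at htot
  have h1 := (ENNReal.mul_right_inj (by simp) (by simp)).1 (htot.trans (mul_one 2).symm)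
  rcases zmod_two_eq s with rfl | rfl
  · rw [h01, h1]
  · exact h1

lemma isProbabilityMeasure_parityChannel (W : Inputs m → Measure Ω)
    [∀ x, IsProbabilityMeasure (W x)] {S : Finset (Fin m)} (hS : S.Nonempty) (s : ZMod 2) :
    IsProbabilityMeasure (parityChannel W S s) := by
  constructor
  rw [← lintegral_one, lintegral_parityChannel]
  simpa using sum_parity_eq hS s

/-- The sums over the inputs which control a bound for a parity channel. -/
lemma sum_lintegral_parity_le {W : Inputs m → Measure Ω} {S : Finset (Fin m)} {z : ℝ≥0∞}
    {f : ZMod 2 → Ω → ℝ≥0∞} (hf : ∀ s, ∫⁻ y, f s y ∂parityChannel W S s ≤ z) :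
    (∀ s, ∑ x, (if parity S x = s then 2 * (2 ^ m : ℝ≥0∞)⁻¹ * ∫⁻ y, f (parity S x) y ∂W x else 0)
      ≤ z) ∧ (2 ^ m : ℝ≥0∞)⁻¹ * ∑ x, ∫⁻ y, f (parity S x) y ∂W x ≤ z := by
  have h1 : ∀ s, ∑ x, (if parity S x = s then
      2 * (2 ^ m : ℝ≥0∞)⁻¹ * ∫⁻ y, f (parity S x) y ∂W x else 0) ≤ z := by
    intro s
    refine le_trans (le_of_eq ?_) (hf s)
    rw [lintegral_parityChannel]
    refine Finset.sum_congr rfl fun x _ => ?_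
    split_ifs with h
    · rw [h]
    · rfl
  refine ⟨h1, ?_⟩
  have h2 := add_le_add (h1 0) (h1 1)
  rw [← sum_zmod_two fun s => ∑ x, (if parity S x = s then
      2 * (2 ^ m : ℝ≥0∞)⁻¹ * ∫⁻ y, f (parity S x) y ∂W x else 0), Finset.sum_comm] at h2
  simp only [Finset.sum_ite_eq, Finset.mem_univ, if_true] at h2
  rw [← Finset.mul_sum, mul_assoc, ← two_mul] at h2
  exact (ENNReal.mul_le_mul_iff_right (by simp) (by simp)).1 h2

end Parity

/-! ### Bhattacharyya bounds under the two polar transforms. -/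

section Synth

variable {m : ℕ} {Y : Type*} [MeasurableSpace Y]

/-- The second parity is unknown to the receiver, so the test function is the minimum, over both of
its values `r`, of `f (s + r) p.1 + f r p.2`. Choosing the true `r` bounds the integral by a sum of
two terms, each averaging to at most `z`. -/
lemma bhattBound_minus (P : Inputs m → Measure Y) [∀ x, IsProbabilityMeasure (P x)]
    {S : Finset (Fin m)} (hS : S.Nonempty) (l : ℕ) (i : Fin (2 ^ l)) {z : ℝ≥0∞}
    (h : BhattBound (parityChannel (synthChannel P l i) S) z) :
    BhattBound (parityChannel (synthChannel P (l + 1) (splitEquiv l (i, 0))) S) (2 * z) := by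
  obtain ⟨f, hf, hf1, hfz⟩ := h
  obtain ⟨-, hsum⟩ := sum_lintegral_parity_le hfz
  set ψ : Inputs m → ℝ≥0∞ := fun x => ∫⁻ y, f (parity S x) y ∂synthChannel P l i x
  set F : ZMod 2 → ((Fin (2 ^ l) → Y) × (Set.Iio i → Inputs m)) ×
      ((Fin (2 ^ l) → Y) × (Set.Iio i → Inputs m)) → ℝ≥0∞ := fun s p =>
    min (f s p.1 + f 0 p.2) (f (s + 1) p.1 + f 1 p.2) with hF
  have hFm : ∀ s, Measurable (F s) := fun s =>
    (((hf s).comp measurable_fst).add ((hf 0).comp measurable_snd)).min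
      (((hf (s + 1)).comp measurable_fst).add ((hf 1).comp measurable_snd))
  have hFle : ∀ s r p, F s p ≤ f (s + r) p.1 + f r p.2 := by
    intro s r p
    rcases zmod_two_eq r with rfl | rfl
    · rw [add_zero]; exact min_le_left _ _
    · exact min_le_right _ _
  have hF1 : ∀ p, 1 ≤ F 0 p * F 1 p := by
    intro p
    have ha := hf1 p.1
    have hb := hf1 p.2
    have h11 : (1 : ZMod 2) + 1 = 0 := rfl
    simp only [hF, zero_add, h11]
    -- Whichever terms attain the minima, the product of the two sums contains `f 0 p.1 * f 1 p.1`
    -- or `f 0 p.2 * f 1 p.2`.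
    rcases min_choice (f 0 p.1 + f 0 p.2) (f 1 p.1 + f 1 p.2) with h | h <;>
    rcases min_choice (f 1 p.1 + f 0 p.2) (f 0 p.1 + f 1 p.2) with h' | h' <;> rw [h, h']
    · exact ha.trans (mul_le_mul' le_self_add le_self_add)
    · exact hb.trans (mul_le_mul' le_add_self le_add_self)
    · rw [mul_comm]
      exact hb.trans (mul_le_mul' le_add_self le_add_self)
    · rw [mul_comm]
      exact ha.trans (mul_le_mul' le_self_add le_self_add)
  refine ⟨fun s o => F s (unfoldOutput m l i 0 o),
    fun s => (hFm s).comp (measurable_unfoldOutput l i 0), fun o => hF1 _, fun s => ?_⟩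
  rw [lintegral_parityChannel]
  have key : ∀ a, parity S a = s → ∫⁻ o, F s (unfoldOutput m l i 0 o)
      ∂synthChannel P (l + 1) (splitEquiv l (i, 0)) a ≤ 2 * z := by
    intro a ha
    rw [lintegral_synthChannel_zero P l i a (hFm s), ← Finset.mul_sum]
    have hb : ∀ b, ∫⁻ p, F s p ∂((synthChannel P l i (a + b)).prod (synthChannel P l i b)) ≤
        ψ (a + b) + ψ b := by
      intro b
      refine (lintegral_mono (hFle s (parity S b))).trans ?_
      have hm1 : Measurable fun p : ((Fin (2 ^ l) → Y) × (Set.Iio i → Inputs m)) ×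
          ((Fin (2 ^ l) → Y) × (Set.Iio i → Inputs m)) => f (s + parity S b) p.1 :=
        (hf _).comp measurable_fst
      have hm2 : Measurable fun p : ((Fin (2 ^ l) → Y) × (Set.Iio i → Inputs m)) ×
          ((Fin (2 ^ l) → Y) × (Set.Iio i → Inputs m)) => f (parity S b) p.2 :=
        (hf _).comp measurable_snd
      rw [lintegral_add_left hm1,
        lintegral_prod _ hm1.aemeasurable, lintegral_prod _ hm2.aemeasurable]
      simp [ψ, parity_add, ha]
    calc (2 ^ m : ℝ≥0∞)⁻¹ * ∑ b, ∫⁻ p, F s p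
          ∂((synthChannel P l i (a + b)).prod (synthChannel P l i b))
        ≤ (2 ^ m : ℝ≥0∞)⁻¹ * ∑ b, (ψ (a + b) + ψ b) := by gcongr with b; exact hb b
      _ = 2 * ((2 ^ m : ℝ≥0∞)⁻¹ * ∑ b, ψ b) := by
          rw [Finset.sum_add_distrib,
            show ∑ b, ψ (a + b) = ∑ b, ψ b from Equiv.sum_comp (Equiv.addLeft a) ψ, two_mul, mul_add]
      _ ≤ 2 * z := by gcongr
  calc ∑ x, (if parity S x = s then 2 * (2 ^ m : ℝ≥0∞)⁻¹ * ∫⁻ o, F s (unfoldOutput m l i 0 o)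
          ∂synthChannel P (l + 1) (splitEquiv l (i, 0)) x else 0)
      ≤ ∑ x, (if parity S x = s then 2 * (2 ^ m : ℝ≥0∞)⁻¹ else 0) * (2 * z) := by
        refine Finset.sum_le_sum fun x _ => ?_
        split_ifs with hx
        · gcongr; exact key x hx
        · simp
    _ = 2 * z := by rw [← Finset.sum_mul, sum_parity_eq hS, one_mul]

/-- Test functions multiply, and of the revealed vector `a` only its parity is used. Averaging over
`a` makes the first input uniform and contributes `z`; the average over inputs of parity `s`
contributes the other `z`. -/
lemma bhattBound_plus (P : Inputs m → Measure Y) [∀ x, IsProbabilityMeasure (P x)]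
    {S : Finset (Fin m)} (l : ℕ) (i : Fin (2 ^ l)) {z : ℝ≥0∞}
    (h : BhattBound (parityChannel (synthChannel P l i) S) z) :
    BhattBound (parityChannel (synthChannel P (l + 1) (splitEquiv l (i, 1))) S) (z * z) := by
  obtain ⟨f, hf, hf1, hfz⟩ := h
  obtain ⟨hsum', hsum⟩ := sum_lintegral_parity_le hfz
  set ψ : Inputs m → ℝ≥0∞ := fun x => ∫⁻ y, f (parity S x) y ∂synthChannel P l i x
  set F : ZMod 2 → Inputs m → ((Fin (2 ^ l) → Y) × (Set.Iio i → Inputs m)) ×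
      ((Fin (2 ^ l) → Y) × (Set.Iio i → Inputs m)) → ℝ≥0∞ := fun s a p =>
    f (parity S a + s) p.1 * f s p.2 with hF
  have hFm : ∀ s a, Measurable (F s a) := fun s a =>
    ((hf _).comp measurable_fst).mul ((hf _).comp measurable_snd)
  have hFm' : ∀ s, Measurable fun q : Inputs m × _ => F s q.1 q.2 := fun s =>
    measurable_from_prod_countable_right (hFm s)
  have hF1 : ∀ a p, 1 ≤ F 0 a p * F 1 a p := by
    intro a p
    have ha := hf1 p.1
    have hb := hf1 p.2
    have h11 : (1 : ZMod 2) + 1 = 0 := rfl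
    simp only [hF]
    rcases zmod_two_eq (parity S a) with h | h <;> rw [h]
    · simp only [zero_add]
      calc 1 ≤ (f 0 p.1 * f 1 p.1) * (f 0 p.2 * f 1 p.2) := one_le_mul ha hb
        _ = _ := by ring
    · simp only [h11, add_zero]
      calc 1 ≤ (f 0 p.1 * f 1 p.1) * (f 0 p.2 * f 1 p.2) := one_le_mul ha hb
        _ = _ := by ring
  refine ⟨fun s o => F s (o.2 ⟨splitEquiv l (i, 0), Set.mem_Iio.2 (splitEquiv_zero_lt_one i)⟩)
    (unfoldOutput m l i 1 o), fun s => (hFm' s).comp (Measurable.prodMk (by fun_prop)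
      (measurable_unfoldOutput l i 1)), fun o => hF1 _ _, fun s => ?_⟩
  rw [lintegral_parityChannel]
  have key : ∀ b, parity S b = s →
      ∫⁻ o, F s (o.2 ⟨splitEquiv l (i, 0), Set.mem_Iio.2 (splitEquiv_zero_lt_one i)⟩)
        (unfoldOutput m l i 1 o) ∂synthChannel P (l + 1) (splitEquiv l (i, 1)) b ≤ z * ψ b := by
    intro b hb
    rw [lintegral_synthChannel_one P l i b (hFm s), ← Finset.mul_sum]
    have ha : ∀ a, ∫⁻ p, F s a p ∂((synthChannel P l i (a + b)).prod (synthChannel P l i b)) =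
        ψ (a + b) * ψ b := by
      intro a
      simp only [hF, ψ, parity_add, hb]
      exact lintegral_prod_mul (hf _).aemeasurable (hf _).aemeasurable
    simp_rw [ha]
    rw [← Finset.sum_mul,
        show ∑ a, ψ (a + b) = ∑ a, ψ a from Equiv.sum_comp (Equiv.addRight b) ψ, ← mul_assoc]
    gcongr
  calc ∑ x, (if parity S x = s then 2 * (2 ^ m : ℝ≥0∞)⁻¹ * ∫⁻ o, F s
          (o.2 ⟨splitEquiv l (i, 0), Set.mem_Iio.2 (splitEquiv_zero_lt_one i)⟩)
          (unfoldOutput m l i 1 o) ∂synthChannel P (l + 1) (splitEquiv l (i, 1)) x else 0)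
      ≤ ∑ x, z * (if parity S x = s then 2 * (2 ^ m : ℝ≥0∞)⁻¹ * ψ x else 0) := by
        refine Finset.sum_le_sum fun x _ => ?_
        split_ifs with hx
        · rw [mul_left_comm]
          gcongr
          exact key x hx
        · simp
    _ ≤ z * z := by
        rw [← Finset.mul_sum]
        gcongr
        exact hsum' s

/-- The exponents of the bounds on the Bhattacharyya parameters of the parity channels. -/
lemma exponentTree_bhattBound (P : Inputs m → Measure Y) [∀ x, IsProbabilityMeasure (P x)]
    {S : Finset (Fin m)} (hS : S.Nonempty) :
    ExponentTree fun l i L =>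
      BhattBound (parityChannel (synthChannel P l i) S) (ENNReal.ofReal ((2 : ℝ) ^ (-L))) where
  zero l i := by
    have := fun s => isProbabilityMeasure_parityChannel (synthChannel P l i) hS s
    simpa using bhattBound_one (parityChannel (synthChannel P l i) S)
  anti l i L L' hL h := h.mono (ENNReal.ofReal_le_ofReal
    (Real.rpow_le_rpow_of_exponent_le (by norm_num) (neg_le_neg hL)))
  minus l i L h := by
    convert bhattBound_minus P hS l i h using 1
    rw [← ENNReal.ofReal_ofNat 2, ← ENNReal.ofReal_mul (by norm_num)]
    rw [show -(L - 1) = 1 + -L by ring, Real.rpow_add (by norm_num), Real.rpow_one]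
  plus l i L h := by
    convert bhattBound_plus P l i h using 1
    rw [← ENNReal.ofReal_mul (by positivity), ← Real.rpow_add (by norm_num)]
    congr 2
    ring

end Synth

/-! ### The mutual information of a binary-input channel -/

section Info

variable {Ω : Type*} [MeasurableSpace Ω]

/-- The law of the output under a uniform input. -/
noncomputable def outputLaw (Q : ZMod 2 → Measure Ω) : Measure Ω :=
  ∑ s : ZMod 2, (2⁻¹ : ℝ≥0∞) • Q s

instance (Q : ZMod 2 → Measure Ω) [∀ s, IsProbabilityMeasure (Q s)] :
    IsProbabilityMeasure (outputLaw Q) := by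
  constructor
  simp [outputLaw, sum_zmod_two, ENNReal.inv_two_add_inv_two]

lemma jointLaw_eq (Q : ZMod 2 → Measure Ω) [∀ s, SFinite (Q s)] :
    jointLaw Q = ∑ s : ZMod 2, (2⁻¹ : ℝ≥0∞) • (Q s).map (Prod.mk s) := by
  simp [jointLaw, Measure.dirac_prod]

instance (Q : ZMod 2 → Measure Ω) [∀ s, IsProbabilityMeasure (Q s)] :
    IsProbabilityMeasure (jointLaw Q) := by
  constructor
  simp [jointLaw, sum_zmod_two, ENNReal.inv_two_add_inv_two]

lemma jointLaw_apply (Q : ZMod 2 → Measure Ω) [∀ s, SFinite (Q s)] {A : Set (ZMod 2 × Ω)}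
    (hA : MeasurableSet A) : jointLaw Q A = ∑ s : ZMod 2, 2⁻¹ * Q s (Prod.mk s ⁻¹' A) := by
  simp [jointLaw_eq, Measure.map_apply measurable_prodMk_left hA]

lemma lintegral_jointLaw (Q : ZMod 2 → Measure Ω) [∀ s, SFinite (Q s)] {F : ZMod 2 × Ω → ℝ≥0∞}
    (hF : Measurable F) : ∫⁻ p, F p ∂jointLaw Q = ∑ s, 2⁻¹ * ∫⁻ y, F (s, y) ∂Q s := by
  rw [jointLaw_eq, lintegral_finsetSum_measure]
  simp [lintegral_smul_measure, lintegral_map hF measurable_prodMk_left]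

lemma integral_jointLaw (Q : ZMod 2 → Measure Ω) [∀ s, IsProbabilityMeasure (Q s)]
    {F : ZMod 2 × Ω → ℝ} (hF : Integrable F (jointLaw Q)) (hFm : Measurable F) :
    ∫ p, F p ∂jointLaw Q = ∑ s, 2⁻¹ * ∫ y, F (s, y) ∂Q s := by
  rw [jointLaw_eq] at hF ⊢
  rw [integral_finsetSum_measure (by simpa [integrable_finsetSum_measure] using hF)]
  refine Finset.sum_congr rfl fun s _ => ?_
  rw [integral_smul_measure, integral_map (by fun_prop) hFm.aestronglyMeasurable]
  simp

lemma jointLaw_marginals (Q : ZMod 2 → Measure Ω) [∀ s, IsProbabilityMeasure (Q s)] :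
    (jointLaw Q).fst.prod (jointLaw Q).snd = jointLaw fun _ => outputLaw Q := by
  have h1 : (jointLaw Q).fst = ∑ s : ZMod 2, (2⁻¹ : ℝ≥0∞) • Measure.dirac s := by
    ext A hA
    rw [Measure.fst_apply hA, jointLaw_apply Q (measurable_fst hA)]
    simp only [Measure.coe_finsetSum, Finset.sum_apply, Measure.smul_apply, smul_eq_mul]
    refine Finset.sum_congr rfl fun s _ => ?_
    rw [Measure.dirac_apply' _ hA]
    by_cases hs : s ∈ A
    · simp [Set.preimage, hs]
    · simp [Set.preimage, hs]
  have h2 : (jointLaw Q).snd = outputLaw Q := by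
    ext A hA
    rw [Measure.snd_apply hA, jointLaw_apply Q (measurable_snd hA)]
    simp [outputLaw, Set.preimage]
  rw [h1, h2]
  ext A hA
  rw [Measure.prod_apply hA, lintegral_finsetSum_measure, jointLaw_apply _ hA]
  refine Finset.sum_congr rfl fun s _ => ?_
  rw [lintegral_smul_measure, lintegral_dirac' _ (measurable_measure_prodMk_left hA), smul_eq_mul]

/-- The densities of a binary-input channel with respect to its output law. -/
lemma exists_density (Q : ZMod 2 → Measure Ω) [∀ s, IsProbabilityMeasure (Q s)] :
    ∃ r : ZMod 2 → Ω → ℝ, (∀ s, Measurable (r s)) ∧ (∀ s y, 0 ≤ r s y) ∧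
      (∀ y, r 0 y + r 1 y = 2) ∧
      ∀ s, Q s = (outputLaw Q).withDensity fun y => ENNReal.ofReal (r s y) := by
  set ν := outputLaw Q with hν
  have h2ν : Q 0 + Q 1 = (2 : ℝ≥0∞) • ν := by
    rw [hν, outputLaw, sum_zmod_two, ← smul_add, smul_smul,
      ENNReal.mul_inv_cancel (by simp) (by simp), one_smul]
  have hac : ∀ s, Q s ≪ ν := by
    have : ∀ s, Q s ≤ (2 : ℝ≥0∞) • ν := by
      intro s
      rw [← h2ν]
      rcases zmod_two_eq s with rfl | rfl
      · exact Measure.le_add_right le_rfl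
      · exact Measure.le_add_left le_rfl
    exact fun s => (this s).absolutelyContinuous.trans
      (Measure.smul_absolutelyContinuous (c := (2 : ℝ≥0∞)))
  have hsum : ∀ᵐ y ∂ν, (Q 0).rnDeriv ν y + (Q 1).rnDeriv ν y = 2 := by
    have h1 := Measure.rnDeriv_add (Q 0) (Q 1) ν
    rw [h2ν] at h1
    have h3 := Measure.rnDeriv_smul_left_of_ne_top ν ν (r := 2) (by simp)
    filter_upwards [h1, h3, Measure.rnDeriv_self ν] with y e1 e2 e3
    rw [e2] at e1
    simp only [Pi.smul_apply, Pi.add_apply, e3, smul_eq_mul, mul_one] at e1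
    exact e1.symm
  -- Truncating one density at `2` and defining the other by subtraction makes nonnegativity and the
  -- sum `2` hold everywhere, not only almost everywhere.
  refine ⟨fun s y => if s = 0 then min ((Q 0).rnDeriv ν y).toReal 2
    else 2 - min ((Q 0).rnDeriv ν y).toReal 2, fun s => ?_, fun s y => ?_, fun y => ?_,
      fun s => ?_⟩
  · dsimp only
    split_ifs <;> fun_prop
  · dsimp only
    split_ifs
    · positivity
    · linarith [min_le_right ((Q 0).rnDeriv ν y).toReal 2]
  · simp
  · conv_lhs => rw [← Measure.withDensity_rnDeriv_eq _ _ (hac s)]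
    refine withDensity_congr_ae ?_
    filter_upwards [hsum] with y hy
    have h0 : (Q 0).rnDeriv ν y ≠ ∞ := fun h => by simp [h] at hy
    have h1 : (Q 1).rnDeriv ν y ≠ ∞ := fun h => by simp [h] at hy
    have hy' : ((Q 0).rnDeriv ν y).toReal + ((Q 1).rnDeriv ν y).toReal = 2 := by
      rw [← ENNReal.toReal_add h0 h1, hy]; rfl
    have hle : ((Q 0).rnDeriv ν y).toReal ≤ 2 := by
      linarith [ENNReal.toReal_nonneg (a := (Q 1).rnDeriv ν y)]
    rw [min_eq_left hle]
    rcases zmod_two_eq s with rfl | rfl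
    · simp [ENNReal.ofReal_toReal h0]
    · rw [if_neg (by decide), show 2 - ((Q 0).rnDeriv ν y).toReal = ((Q 1).rnDeriv ν y).toReal by
        linarith, ENNReal.ofReal_toReal h1]

open InformationTheory in
lemma info_eq_integral (Q : ZMod 2 → Measure Ω) [∀ s, IsProbabilityMeasure (Q s)]
    {r : ZMod 2 → Ω → ℝ} (hr : ∀ s, Measurable (r s)) (hr0 : ∀ s y, 0 ≤ r s y)
    (hr2 : ∀ y, r 0 y + r 1 y = 2)
    (hQ : ∀ s, Q s = (outputLaw Q).withDensity fun y => ENNReal.ofReal (r s y)) :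
    info Q * Real.log 2 =
      ∫ y, 2⁻¹ * (klFun (r 0 y) + klFun (r 1 y)) ∂outputLaw Q ∧
    ∀ s, Integrable (fun y => klFun (r s y)) (outputLaw Q) := by
  have hrle : ∀ s y, r s y ≤ 2 := by
    intro s y
    have := hr2 y
    rcases zmod_two_eq s with rfl | rfl
    · linarith [hr0 1 y]
    · linarith [hr0 0 y]
  have hrm : Measurable fun p : ZMod 2 × Ω => r p.1 p.2 := measurable_from_prod_countable_right hr
  obtain ⟨C, hC⟩ := (isCompact_Icc (a := (0 : ℝ)) (b := 2)).exists_bound_of_continuousOn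
    continuous_klFun.continuousOn
  have hb : ∀ s y, ‖klFun (r s y)‖ ≤ C := fun s y => hC _ ⟨hr0 s y, hrle s y⟩
  have hi : ∀ s, Integrable (fun y => klFun (r s y)) (outputLaw Q) := fun s =>
    Integrable.of_bound (measurable_klFun.comp (hr s)).aestronglyMeasurable C
      (ae_of_all _ fun y => hb s y)
  refine ⟨?_, hi⟩
  have hd : jointLaw Q = (jointLaw fun _ => outputLaw Q).withDensity
      fun p => ENNReal.ofReal (r p.1 p.2) := by
    ext A hA
    rw [jointLaw_apply Q hA, withDensity_apply _ hA, ← lintegral_indicator hA,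
      lintegral_jointLaw _ (hrm.ennreal_ofReal.indicator hA)]
    refine Finset.sum_congr rfl fun s _ => ?_
    congr 1
    conv_lhs => rw [hQ s, withDensity_apply _ (measurable_prodMk_left hA),
      ← lintegral_indicator (measurable_prodMk_left hA)]
    rfl
  have hac : jointLaw Q ≪ jointLaw fun _ => outputLaw Q := by
    rw [hd]
    exact withDensity_absolutelyContinuous _ _
  rw [info, mutualInfo, div_mul_cancel₀ _ (Real.log_pos (by norm_num)).ne', jointLaw_marginals,
    toReal_klDiv_eq_integral_klFun hac]
  have hae : (fun p => klFun ((jointLaw Q).rnDeriv (jointLaw fun _ => outputLaw Q) p).toReal)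
      =ᵐ[jointLaw fun _ => outputLaw Q] fun p => klFun (r p.1 p.2) := by
    have h := Measure.rnDeriv_withDensity (jointLaw fun _ => outputLaw Q) hrm.ennreal_ofReal
    rw [← hd] at h
    filter_upwards [h] with p hp
    rw [hp, ENNReal.toReal_ofReal (hr0 _ _)]
  have hkm : Measurable fun p : ZMod 2 × Ω => klFun (r p.1 p.2) := measurable_klFun.comp hrm
  rw [integral_congr_ae hae, integral_jointLaw _ (Integrable.of_bound hkm.aestronglyMeasurable C
    (ae_of_all _ fun p => hb _ _)) hkm, sum_zmod_two, integral_const_mul,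
    integral_add (hi 0) (hi 1), mul_add]

lemma lintegral_channel {Q : ZMod 2 → Measure Ω} {r : ZMod 2 → Ω → ℝ}
    (hr : ∀ s, Measurable (r s))
    (hQ : ∀ s, Q s = (outputLaw Q).withDensity fun y => ENNReal.ofReal (r s y))
    (s : ZMod 2) {f : Ω → ℝ≥0∞} (hf : Measurable f) :
    ∫⁻ y, f y ∂Q s = ∫⁻ y, ENNReal.ofReal (r s y) * f y ∂outputLaw Q := by
  conv_lhs => rw [hQ s]
  rw [lintegral_withDensity_eq_lintegral_mul _ (hr s).ennreal_ofReal hf]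
  rfl

/-! ### Comparison of mutual information with the Bhattacharyya parameter. -/

lemma negMulLog_le_sqrt {p : ℝ} (hp : 0 ≤ p) : Real.negMulLog p ≤ 2 * (√p - p) := by
  rcases hp.eq_or_lt with rfl | hp
  · simp
  have hs : 0 < √p := Real.sqrt_pos.2 hp
  have h1 : Real.log p = -2 * Real.log (√p)⁻¹ := by
    rw [Real.log_inv, Real.log_sqrt hp.le]; ring
  have h2 := Real.log_le_sub_one_of_pos (inv_pos.2 hs)
  have h3 : p * ((√p)⁻¹ - 1) = √p - p := by
    rw [mul_sub, mul_one, ← div_eq_mul_inv, Real.div_sqrt]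
  rw [Real.negMulLog, h1]
  nlinarith

open InformationTheory in
-- With `p = a / 2` and `q = b / 2`, the left side is the entropy of `(p, q)` in nats, at most `2
-- (√p + √q - 1)`. This is at most `2 √(pq) = √(ab)`, since `(√p + √q - 1)² ≥ 0` and `p + q = 1`.
lemma log_two_sub_klFun_le {a b : ℝ} (ha : 0 ≤ a) (hb : 0 ≤ b) (hab : a + b = 2) :
    Real.log 2 - 2⁻¹ * (klFun a + klFun b) ≤ √(a * b) := by
  have hlog : ∀ x : ℝ, 0 ≤ x → x * Real.log x = x * Real.log 2 - 2 * Real.negMulLog (x / 2) := by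
    intro x hx
    rcases hx.eq_or_lt with rfl | hx
    · simp
    · rw [Real.negMulLog, Real.log_div hx.ne' (by norm_num)]; ring
  have h1 := negMulLog_le_sqrt (by positivity : 0 ≤ a / 2)
  have h2 := negMulLog_le_sqrt (by positivity : 0 ≤ b / 2)
  have h3 : √(a / 2) + √(b / 2) ≤ 1 + √(a * b) / 2 := by
    have e : √(a * b) = 2 * (√(a / 2) * √(b / 2)) := by
      rw [← Real.sqrt_mul (by positivity), show a * b = 2 ^ 2 * (a / 2 * (b / 2)) by ring,
        Real.sqrt_mul (by positivity), Real.sqrt_sq (by norm_num)]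
    have e1 := Real.sq_sqrt (by positivity : 0 ≤ a / 2)
    have e2 := Real.sq_sqrt (by positivity : 0 ≤ b / 2)
    rw [e]
    nlinarith [sq_nonneg (√(a / 2) + √(b / 2) - 1)]
  rw [klFun_apply, klFun_apply, hlog a ha, hlog b hb]
  have : a * Real.log 2 + b * Real.log 2 = 2 * Real.log 2 := by rw [← add_mul, hab]
  linarith

open InformationTheory in
lemma klFun_le_sq {a : ℝ} (ha : 0 ≤ a) : klFun a ≤ (a - 1) ^ 2 := by
  rcases ha.eq_or_lt with rfl | ha
  · norm_num [klFun_apply]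
  · rw [klFun_apply]
    nlinarith [Real.log_le_sub_one_of_pos ha]

/-- Arithmetic-geometric mean: this is why test functions with product at least `1` bound the
Bhattacharyya integral. -/
lemma ofReal_sqrt_mul_le {a b : ℝ} (ha : 0 ≤ a) (hb : 0 ≤ b) {f g : ℝ≥0∞} (h : 1 ≤ f * g) :
    2 * ENNReal.ofReal √(a * b) ≤ ENNReal.ofReal a * f + ENNReal.ofReal b * g := by
  rcases ha.eq_or_lt with rfl | ha
  · simp
  rcases hb.eq_or_lt with rfl | hb
  · simp
  by_cases hf : f = ∞
  · simp [hf, ENNReal.mul_top, ha]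
  by_cases hg : g = ∞
  · simp [hg, ENNReal.mul_top, hb]
  lift f to NNReal using hf
  lift g to NNReal using hg
  have h' : (1 : ℝ) ≤ f * g := by exact_mod_cast h
  rw [← ENNReal.ofReal_coe_nnreal, ← ENNReal.ofReal_coe_nnreal, ← ENNReal.ofReal_mul ha.le,
    ← ENNReal.ofReal_mul hb.le, ← ENNReal.ofReal_add (by positivity) (by positivity),
    ← ENNReal.ofReal_ofNat 2, ← ENNReal.ofReal_mul (by norm_num)]
  refine ENNReal.ofReal_le_ofReal ?_
  refine abs_le_of_sq_le_sq' ?_ (by positivity) |>.2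
  rw [mul_pow, Real.sq_sqrt (by positivity)]
  nlinarith [sq_nonneg (a * f - b * g), mul_pos ha hb,
    mul_le_mul_of_nonneg_left h' (mul_pos ha hb).le]

lemma one_sub_info_le (Q : ZMod 2 → Measure Ω) [∀ s, IsProbabilityMeasure (Q s)] {z : ℝ}
    (hz : 0 ≤ z) (h : BhattBound Q (ENNReal.ofReal z)) : (1 - info Q) * Real.log 2 ≤ z := by
  obtain ⟨f, hf, hf1, hfz⟩ := h
  obtain ⟨r, hr, hr0, hr2, hQ⟩ := exists_density Q
  obtain ⟨hI, hint⟩ := info_eq_integral Q hr hr0 hr2 hQ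
  have hint' : Integrable (fun y => 2⁻¹ * (InformationTheory.klFun (r 0 y) +
      InformationTheory.klFun (r 1 y))) (outputLaw Q) := ((hint 0).add (hint 1)).const_mul _
  have hsm : Measurable fun y => √(r 0 y * r 1 y) := ((hr 0).mul (hr 1)).sqrt
  have hl : ∫⁻ y, ENNReal.ofReal √(r 0 y * r 1 y) ∂outputLaw Q ≤ ENNReal.ofReal z := by
    refine (ENNReal.mul_le_mul_iff_right (a := 2) (by simp) (by simp)).1 ?_
    rw [← lintegral_const_mul _ hsm.ennreal_ofReal]
    refine (lintegral_mono fun y => ofReal_sqrt_mul_le (hr0 0 y) (hr0 1 y) (hf1 y)).trans ?_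
    have hm0 : Measurable fun y => ENNReal.ofReal (r 0 y) * f 0 y :=
      (hr 0).ennreal_ofReal.mul (hf 0)
    rw [lintegral_add_left hm0, ← lintegral_channel hr hQ 0 (hf 0),
      ← lintegral_channel hr hQ 1 (hf 1), two_mul]
    exact add_le_add (hfz 0) (hfz 1)
  have hsi : Integrable (fun y => √(r 0 y * r 1 y)) (outputLaw Q) := by
    refine ⟨hsm.aestronglyMeasurable, ?_⟩
    rw [hasFiniteIntegral_iff_ofReal (ae_of_all _ fun y => Real.sqrt_nonneg _)]
    exact hl.trans_lt ENNReal.ofReal_lt_top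
  have hs : ∫ y, √(r 0 y * r 1 y) ∂outputLaw Q ≤ z := by
    rw [integral_eq_lintegral_of_nonneg_ae (ae_of_all _ fun y => Real.sqrt_nonneg _)
      hsm.aestronglyMeasurable]
    exact ENNReal.toReal_le_of_le_ofReal hz hl
  calc (1 - info Q) * Real.log 2
      = ∫ y, (Real.log 2 - 2⁻¹ * (InformationTheory.klFun (r 0 y) +
        InformationTheory.klFun (r 1 y))) ∂outputLaw Q := by
        rw [integral_sub (integrable_const _) hint', ← hI]
        simp [sub_mul]
    _ ≤ ∫ y, √(r 0 y * r 1 y) ∂outputLaw Q :=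
        integral_mono ((integrable_const _).sub hint') hsi fun y =>
          log_two_sub_klFun_le (hr0 0 y) (hr0 1 y) (hr2 y)
    _ ≤ z := hs

/-- With `d = r s - 1`, the information in nats is at most `∫ d²`, because `klFun a ≤ (a - 1)²`. A
second-order test function lowers the bound from `1` by `∫ d² / 4`. -/
lemma bhattBound_of_info (Q : ZMod 2 → Measure Ω) [∀ s, IsProbabilityMeasure (Q s)] :
    BhattBound Q (ENNReal.ofReal (1 - info Q * Real.log 2 / 4)) := by
  obtain ⟨r, hr, hr0, hr2, hQ⟩ := exists_density Q
  obtain ⟨hI, hint⟩ := info_eq_integral Q hr hr0 hr2 hQ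
  have hrle : ∀ s y, r s y ≤ 2 := by
    intro s y
    have := hr2 y
    rcases zmod_two_eq s with rfl | rfl
    · linarith [hr0 1 y]
    · linarith [hr0 0 y]
  have hri : ∀ s, Integrable (r s) (outputLaw Q) := fun s =>
    Integrable.of_bound (hr s).aestronglyMeasurable 2 (ae_of_all _ fun y => by
      rw [Real.norm_of_nonneg (hr0 s y)]; exact hrle s y)
  have hr1 : ∀ s, ∫ y, r s y ∂outputLaw Q = 1 := by
    intro s
    have h := lintegral_channel hr hQ s (f := fun _ => 1) measurable_const
    simp only [mul_one, lintegral_const, measure_univ] at h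
    rw [integral_eq_lintegral_of_nonneg_ae (ae_of_all _ fun y => hr0 s y)
      (hr s).aestronglyMeasurable, ← h]
    rfl
  have hxi : ∀ s, Integrable (fun y => (r s y - 1) ^ 2) (outputLaw Q) := fun s =>
    Integrable.of_bound (((hr s).sub_const 1).pow_const 2).aestronglyMeasurable 1
      (ae_of_all _ fun y => by
        rw [Real.norm_of_nonneg (sq_nonneg _)]
        nlinarith [hr0 s y, hrle s y])
  have hsq : ∀ s, info Q * Real.log 2 ≤ ∫ y, (r s y - 1) ^ 2 ∂outputLaw Q := by
    intro s
    rw [hI]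
    refine integral_mono (((hint 0).add (hint 1)).const_mul _) (hxi s) fun y => ?_
    have h0 := klFun_le_sq (hr0 0 y)
    have h1 := klFun_le_sq (hr0 1 y)
    have h2 : r 1 y = 2 - r 0 y := by linarith [hr2 y]
    rw [h2] at h1
    dsimp only
    rcases zmod_two_eq s with rfl | rfl
    · rw [h2]; nlinarith
    · rw [h2]; nlinarith
  have hm : ∀ s, Measurable fun y => 1 - (r s y - 1) / 2 + (r s y - 1) ^ 2 / 8 := fun s => by
    have := hr s
    fun_prop
  -- The test function `1 - d/2 + d²/8` is the quadratic Taylor polynomial of `exp (-d/2)`. Since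
  -- `d` changes sign with `s`, the product of the two is `1 + d⁴/64`.
  refine ⟨fun s y => ENNReal.ofReal (1 - (r s y - 1) / 2 + (r s y - 1) ^ 2 / 8),
    fun s => (hm s).ennreal_ofReal, fun y => ?_, fun s => ?_⟩
  · have h2 : r 1 y = 2 - r 0 y := by linarith [hr2 y]
    rw [← ENNReal.ofReal_mul (by nlinarith [sq_nonneg (r 0 y - 1), hrle 0 y]),
      ENNReal.one_le_ofReal, h2]
    nlinarith [sq_nonneg ((r 0 y - 1) ^ 2)]
  · rw [lintegral_channel hr hQ s (hm s).ennreal_ofReal]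
    -- The product is `1 + d/2 - 3d²/8 + d³/8`, and `d ≤ 1` absorbs the cubic term; `d` itself has
    -- mean `0`.
    have hp : ∀ y, ENNReal.ofReal (r s y) *
        ENNReal.ofReal (1 - (r s y - 1) / 2 + (r s y - 1) ^ 2 / 8) ≤
        ENNReal.ofReal (1 + (r s y - 1) / 2 - (r s y - 1) ^ 2 / 4) := by
      intro y
      rw [← ENNReal.ofReal_mul (hr0 s y)]
      refine ENNReal.ofReal_le_ofReal ?_
      nlinarith [mul_nonneg (sq_nonneg (r s y - 1)) (sub_nonneg.2 (hrle s y))]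
    have hi0 : Integrable (fun y => (r s y - 1) / 2) (outputLaw Q) :=
      ((hri s).sub (integrable_const 1)).div_const 2
    have hi1 : Integrable (fun y => 1 + (r s y - 1) / 2) (outputLaw Q) :=
      (integrable_const _).add hi0
    refine (lintegral_mono hp).trans ?_
    have hi2 : Integrable (fun y => 1 + (r s y - 1) / 2 - (r s y - 1) ^ 2 / 4) (outputLaw Q) :=
      hi1.sub ((hxi s).div_const 4)
    rw [← ofReal_integral_eq_lintegral_ofReal hi2
      (ae_of_all _ fun y => ?_)]
    · refine ENNReal.ofReal_le_ofReal ?_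
      rw [integral_sub hi1 ((hxi s).div_const 4), integral_add (integrable_const _) hi0,
        integral_div, integral_div,
        integral_sub (hri s) (integrable_const _), hr1 s]
      simp only [integral_const, probReal_univ, smul_eq_mul]
      linarith [hsq s]
    · change 0 ≤ 1 + (r s y - 1) / 2 - (r s y - 1) ^ 2 / 4
      nlinarith [hr0 s y, hrle s y]

end Info

/-- For `S = ∅` the parity channels are not probability measures (masses `2` and `0`), so the
general bounds do not apply; the joint law is a product with a point mass. -/
lemma info_parityChannel_empty {m : ℕ} {Ω : Type*} [MeasurableSpace Ω]
    (W : Inputs m → Measure Ω) [∀ x, IsProbabilityMeasure (W x)] :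
    info (parityChannel W ∅) = 0 := by
  have h0 : parityChannel W ∅ 0 Set.univ = 2 := by
    rw [← lintegral_one, lintegral_parityChannel]
    simp [parity, mul_left_comm _ (2 : ℝ≥0∞), ENNReal.mul_inv_cancel]
  have h1 : parityChannel W ∅ 1 = 0 := by
    simp [parityChannel]
  have : IsFiniteMeasure (parityChannel W ∅ 0) := ⟨by rw [h0]; exact ENNReal.ofNat_lt_top⟩
  have hJ : jointLaw (parityChannel W ∅) =
      (Measure.dirac 0).prod ((2⁻¹ : ℝ≥0∞) • parityChannel W ∅ 0) := by
    rw [jointLaw, sum_zmod_two, h1, Measure.prod_zero, smul_zero, add_zero,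
      Measure.prod_smul_right]
  have hp : IsProbabilityMeasure ((2⁻¹ : ℝ≥0∞) • parityChannel W ∅ 0) := by
    constructor
    rw [Measure.smul_apply, h0, smul_eq_mul, ENNReal.inv_mul_cancel (by simp) (by simp)]
  rw [info, mutualInfo, hJ, Measure.fst_prod, Measure.snd_prod, InformationTheory.klDiv_self]
  simp

end MACPolar

/-! ### From exponents back to mutual information. -/

theorem mainTheorem8 {m : ℕ} {Y : Type*} [MeasurableSpace Y]
    (P : MACPolar.Inputs m → Measure Y) [∀ x, IsProbabilityMeasure (P x)]
    (S : Finset (Fin m)) (ε α : ℝ) (hε : 0 < ε) (hε1 : ε < 1) (hα : α < 1 / 2) :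
    Tendsto
      (fun l : ℕ =>
        (({i : Fin (2 ^ l) |
            1 - ε < MACPolar.info (MACPolar.parityChannel (MACPolar.synthChannel P l i) S) ∧
            MACPolar.info (MACPolar.parityChannel (MACPolar.synthChannel P l i) S) <
              1 - (2 : ℝ) ^ (-((2 : ℝ) ^ l) ^ α)}.ncard : ℕ) : ℝ) / (2 : ℝ) ^ l)
      atTop (𝓝 0) := by
  open MACPolar in
  rcases S.eq_empty_or_nonempty with rfl | hS
  · have h : ∀ l : ℕ, {i : Fin (2 ^ l) |
        1 - ε < info (parityChannel (synthChannel P l i) ∅) ∧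
        info (parityChannel (synthChannel P l i) ∅) < 1 - (2 : ℝ) ^ (-((2 : ℝ) ^ l) ^ α)} = ∅ := by
      intro l
      ext i
      simp only [info_parityChannel_empty, Set.mem_ofPred_eq, Set.mem_empty_iff_false, iff_false]
      rintro ⟨h, -⟩
      linarith
    simp only [h, Set.ncard_empty, Nat.cast_zero, zero_div]
    exact tendsto_const_nhds
  have hlog : 0 < Real.log 2 := Real.log_pos (by norm_num)
  have hlog1 : Real.log 2 < 1 := by linarith [Real.log_two_lt_d9]
  have hlog2 : 1 / 2 < Real.log 2 := by linarith [Real.log_two_gt_d9]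
  -- `I > 1 - ε` gives the bound `1 - δ = 2 ^ (-L₀)` through `bhattBound_of_info`, so `L₀` is
  -- admissible.
  set δ := (1 - ε) * Real.log 2 / 4 with hδ
  have hδ0 : 0 < δ := by have := sub_pos.2 hε1; positivity
  have hδ1 : δ < 1 := by nlinarith
  set L₀ := -Real.logb 2 (1 - δ) with hL₀
  have hL₀pos : 0 < L₀ :=
    neg_pos.2 (Real.logb_neg (by norm_num) (by linarith) (by linarith))
  have h2L₀ : (2 : ℝ) ^ (-L₀) = 1 - δ := by
    rw [hL₀, neg_neg, Real.rpow_logb (by norm_num) (by norm_num) (by linarith)]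
  obtain ⟨γ, hγ, hγ2⟩ := exists_between (max_lt hα (by norm_num : (0 : ℝ) < 1 / 2))
  obtain ⟨hαγ, hγ0⟩ := max_lt_iff.1 hγ
  have hlim := tendsto_fraction (exponentTree_bhattBound P hS) hL₀pos hγ0 hγ2
  refine tendsto_of_tendsto_of_tendsto_of_le_of_le' tendsto_const_nhds hlim
    (Eventually.of_forall fun l => by positivity) ?_
  -- The room between `α` and `γ` yields one extra bit of exponent, that is a factor `1/2`, which
  -- beats the division by `Real.log 2 > 1 / 2` in `one_sub_info_le`.
  have hgap : ∀ᶠ l : ℕ in atTop, ((2 : ℝ) ^ l) ^ α + 1 ≤ (2 : ℝ) ^ (γ * l) := by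
    have hx : Tendsto (fun l : ℕ => (2 : ℝ) ^ l) atTop atTop :=
      tendsto_pow_atTop_atTop_of_one_lt (by norm_num)
    have h1 := ((tendsto_rpow_atTop (sub_pos.2 hαγ)).comp hx).eventually_ge_atTop 2
    have h2 := ((tendsto_rpow_atTop hγ0).comp hx).eventually_ge_atTop 2
    filter_upwards [h1, h2] with l h1 h2
    have hp : (0 : ℝ) < 2 ^ l := by positivity
    have h3 : ((2 : ℝ) ^ l) ^ γ = ((2 : ℝ) ^ l) ^ α * ((2 : ℝ) ^ l) ^ (γ - α) := by
      rw [← Real.rpow_add hp, add_sub_cancel]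
    have h4 := mul_le_mul_of_nonneg_left h1 (Real.rpow_nonneg hp.le α)
    simp only [Function.comp] at h2 h4
    rw [mul_comm γ, Real.rpow_mul (by norm_num), Real.rpow_natCast]
    linarith
  filter_upwards [hgap] with l hl
  refine div_le_div_of_nonneg_right (Nat.cast_le.2 (Set.ncard_le_ncard (fun i hi => ?_)
    (Set.toFinite _))) (by positivity)
  obtain ⟨h1, h2⟩ := hi
  have := fun s => isProbabilityMeasure_parityChannel (synthChannel P l i) hS s
  refine ⟨(bhattBound_of_info _).mono (ENNReal.ofReal_le_ofReal ?_), fun hB => ?_⟩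
  · rw [h2L₀, hδ]
    nlinarith
  · have h3 := one_sub_info_le _ (by positivity) hB
    have h4 : (2 : ℝ) ^ (-(2 : ℝ) ^ (γ * l)) ≤ 2⁻¹ * (2 : ℝ) ^ (-((2 : ℝ) ^ l) ^ α) := by
      rw [← Real.rpow_neg_one 2, ← Real.rpow_add (by norm_num)]
      exact Real.rpow_le_rpow_of_exponent_le (by norm_num) (by linarith)
    have h5 : (0 : ℝ) < (2 : ℝ) ^ (-((2 : ℝ) ^ l) ^ α) := by positivity
    nlinarith
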